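/- Let $A$ be an $n\times n$ complex matrix. Then $A$ has a Jordan form $A=QJQ^{-1}$; fix any one, with Jordan blocks of sizes $n_1,\dots,n_u\ge 1$ and eigenvalues $\lambda_1,\dots,\lambda_u$, where blocks with the same eigenvalue are listed from larger to smaller. Let $\mathcal L(A)$ be the lattice of $A$-invariant subspaces. Notation. Let $S_m$ be the $m\times m$ backward shift (ones on the first superdiagonal). For block sizes $s=(s_1,\dots,s_u)$ and powers $k=(k_1,\dots,k_u)$ put $Z_s(k)=\mathrm{diag}(S_{s_1}^{k_1},\dots,S_{s_u}^{k_u})$. For a set $E$ of complex numbers let $s_E$ be the sizes obtained from $\mathbf n=(n_1,\dots,n_u)$ by expanding, for each eigenvalue $\lambda\in E$, every block whose size falls short of the largest block of $\lambda$ by more than one to one less than that largest size; $J_E$ is the Jordan matrix with block sizes $s_E$ and eigenvalues $\lambda_i$, and $\mathbb C^n$ (in Jordan coordinates) is included in the space of $J_E$ as the initial positions of each block. A pair $(k,T)$ represents $N$ over $s_E$ if $T$ is invertible, commutes with $J_E$, maps the first basis vector (the eigenvector) of each block $j$ to a combination of eigenvectors whose rightmost block is $j$, and the image of $Q^{-1}N$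 in the space of $J_E$ is $\ker(Z_{s_E}(k)T^{-1})$. A subspace $N$ is marked if some Jordan basis for $A$ acting on $N$ extends to a Jordan basis for $A$ on $\mathbb C^n$; it is marked at $\lambda$ if its intersection with the generalized eigenspace of $\lambda$ is marked. For $N\in\mathcal L(A)$ let $k_j(N)$ be the largest length of a Jordan chain $v,(J-\lambda_j)v,\dots,(J-\lambda_j)^{k-1}v$ in $Q^{-1}N$ whose eigenvector $(J-\lambda_j)^{k-1}v$ has $j$ as the rightmost block in which it is nonzero ($0$ if there is none). Two invariant subspaces have the same type if they have the same $k(N)=(k_j(N))_j$, and the same refined type if moreover they fail to be marked at the same eigenvalues. Types are ordered by: $t\le t'$ if some subspace of type $t$ lies in some subspace of type $t'$. Let $\hat s$ be the sizes expanded at all eigenvalues. Then: 1. A subspace of $\mathbb C^n$ is $A$-invariant if and only if it is represented over $\hat s$ by some $(k,T)$ with $k\le \mathbf n$ (componentwise); it is invariant and marked if and only if it is represented over the original sizes $\mathbf n$ by some $(k,T)$ with $k\le \mathbf n$. 2. The matrices $Z_{\hat s}(k)$, $k\le \mathbf n$, ordered by inclusion of kernels, form a lattice isomorphic via $k\mapsto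 Z_{\hat s}(k)$ to $\prod_i\{0,\dots,n_i\}$ with the componentwise order. There is an order isomorphism from the types of $A$-invariant subspaces onto this lattice that takes the type of $N$ to the unique matrix $Z_{\hat s}(k)$, $k\le \mathbf n$, for which $N$ is represented over $\hat s$ by some $(k,T)$. 3. $\dim N=\sum_j k_j(N)$ for $N\in\mathcal L(A)$. There is a lattice homomorphism $\prod_i\{0,\dots,n_i\}\to\mathcal L(A)$ whose value at each $k$ is a subspace for which the construction of item 4 gives the unexpanded matrix $Z_{\mathbf n}(k)$. For $N\in\mathcal L(A)$ and every $k\le k(N)$ there is an invariant $N'\subseteq N$ with $k(N')=k$; for $N$ marked and every $k$ with $k(N)\le k\le \mathbf n$ there is a marked invariant $N'\supseteq N$ with $k(N')=k$. 4. (Expanding only where needed.) Every $N\in\mathcal L(A)$ has exactly one matrix $Z_{s_E}(k)$, $k\le \mathbf n$, where $E$ is the set of eigenvalues at which $N$ is not marked, such that $N$ is represented over $s_E$ by some $(k,T)$. Two invariant subspaces have the same such matrix (with its block sizes) if and only if they have the same refined type. This gives a bijection from refined types onto the set of all $Z_{s_E}(k)$ (with their block sizes) with $k\le \mathbf n$ and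 such that for each $\lambda\in E$ there are blocks $i,j$ with eigenvalue $\lambda$, $k_i<n_i$, $k_j<n_j$, $n_i+1<n_j$ and $k_i+1<k_j$. 5. The hyperinvariant subspaces (those invariant under every matrix commuting with $A$) are exactly the invariant subspaces whose matrix in item 4 is an unexpanded $Z_{\mathbf n}(r)$ with $r\le \mathbf n$ and, for all $i\le j$ with $\lambda_i=\lambda_j$, $r_j\le r_i$ and $n_j-r_j\le n_i-r_i$. They form a sublattice of $\mathcal L(A)$, and $N\mapsto r$ is a lattice isomorphism from it onto the lattice of such $r$. -/

import Mathlib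

open Matrix

/-- Positions in a block structure: the pair `⟨i, a⟩` is position `a` (counted from `0`)
of the `i`-th block, which has size `s i`. -/
abbrev BlockIdx {u : ℕ} (s : Fin u → ℕ) : Type := Σ i : Fin u, Fin (s i)

/-- The `m × m` backward shift: ones on the first superdiagonal, zeros elsewhere. -/
def backwardShift (m : ℕ) : Matrix (Fin m) (Fin m) ℂ :=
  Matrix.of fun a b => if (b : ℕ) = (a : ℕ) + 1 then 1 else 0

/-- The Jordan matrix with blocks of sizes `s i` and eigenvalues `μ i`. -/
def jordanMatrix {u : ℕ} (s : Fin u → ℕ) (μ : Fin u → ℂ) :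
    Matrix (BlockIdx s) (BlockIdx s) ℂ :=
  Matrix.blockDiagonal' fun i => μ i • (1 : Matrix (Fin (s i)) (Fin (s i)) ℂ) + backwardShift (s i)

/-- The block diagonal matrix `Z` whose `i`-th diagonal block is the `k i`-th power of the
backward shift of size `s i`. -/
def shiftMatrix {u : ℕ} (s : Fin u → ℕ) (k : Fin u → ℕ) :
    Matrix (BlockIdx s) (BlockIdx s) ℂ :=
  Matrix.blockDiagonal' fun i => backwardShift (s i) ^ k i

/-- The row selection matrix `P` from the block structure `t` to the block structure `s`;
for `s ≤ t` its transpose is the inclusion of the space of the small block structure into the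
space of the large one, as the initial positions of each block. -/
def rowSelection {u : ℕ} (s t : Fin u → ℕ) : Matrix (BlockIdx s) (BlockIdx t) ℂ :=
  Matrix.of fun p q => if p.1 = q.1 ∧ (p.2 : ℕ) = (q.2 : ℕ) then 1 else 0

/-- The lattice of invariant subspaces of a square complex matrix. -/
abbrev invariantLattice {n : ℕ} (A : Matrix (Fin n) (Fin n) ℂ) :
    Sublattice (Submodule ℂ (Fin n → ℂ)) :=
  Module.End.invtSubmodule (Matrix.toLin' A)

/-- The sublattice of hyperinvariant subspaces: those invariant under every matrix that
commutes with `A`. -/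
def hyperinvariantLattice {n : ℕ} (A : Matrix (Fin n) (Fin n) ℂ) :
    Sublattice (Submodule ℂ (Fin n → ℂ)) :=
  ⨅ B : {B : Matrix (Fin n) (Fin n) ℂ // Commute A B}, invariantLattice B.1

/-- The vectors `c ⟨i, a⟩`, `a < m i`, form a Jordan basis for `A` acting on `N`: a basis of `N`
made of Jordan chains `c ⟨i, 0⟩, c ⟨i, 1⟩, …`, each starting with an eigenvector. -/
def IsJordanBasis {n : ℕ} (A : Matrix (Fin n) (Fin n) ℂ) (N : Submodule ℂ (Fin n → ℂ))
    {r : ℕ} (m : Fin r → ℕ) (c : BlockIdx m → Fin n → ℂ) : Prop :=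
  LinearIndependent ℂ c ∧ Submodule.span ℂ (Set.range c) = N ∧
    ∃ ν : Fin r → ℂ, ∀ i : Fin r,
      (∀ h : 0 < m i, A *ᵥ c ⟨i, 0, h⟩ = ν i • c ⟨i, 0, h⟩) ∧
      (∀ (a : ℕ) (h : a + 1 < m i),
        A *ᵥ c ⟨i, a + 1, h⟩ = ν i • c ⟨i, a + 1, h⟩ + c ⟨i, a, Nat.lt_of_succ_lt h⟩)

/-- `N` is marked for `A`: some Jordan basis for `A` acting on `N` can be extended, by adjoining
new vectors, to a Jordan basis for `A` on the whole space. -/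
def IsMarked {n : ℕ} (A : Matrix (Fin n) (Fin n) ℂ) (N : Submodule ℂ (Fin n → ℂ)) : Prop :=
  ∃ (r : ℕ) (m : Fin r → ℕ) (c : BlockIdx m → Fin n → ℂ)
    (t : ℕ) (l : Fin t → ℕ) (b : BlockIdx l → Fin n → ℂ),
    IsJordanBasis A N m c ∧ IsJordanBasis A ⊤ l b ∧ Set.range c ⊆ Set.range b

/-- The eigenvalues at which `N` is not marked: those whose component of `N` (the intersection
with the generalized eigenspace) is not marked. -/
def nonMarkedEigenvalues {n : ℕ} (A : Matrix (Fin n) (Fin n) ℂ)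
    (N : Submodule ℂ (Fin n → ℂ)) : Set ℂ :=
  {z | ¬ IsMarked A (N ⊓ Module.End.maxGenEigenspace (Matrix.toLin' A) z)}

/-- A Jordan form `A = Q J Q⁻¹`; blocks with the same eigenvalue are listed from larger to
smaller. -/
structure JordanForm {n : ℕ} (A : Matrix (Fin n) (Fin n) ℂ) where
  /-- the number of Jordan blocks -/
  u : ℕ
  /-- the sizes of the Jordan blocks -/
  size : Fin u → ℕ
  /-- the eigenvalues of the Jordan blocks -/
  eig : Fin u → ℂ
  size_pos : ∀ i, 0 < size i
  size_anti : ∀ i j, i ≤ j → eig i = eig j → size j ≤ size i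
  /-- the matrix that puts `A` into Jordan form -/
  Q : Matrix (Fin n) (BlockIdx size) ℂ
  /-- the inverse of `Q` -/
  Qinv : Matrix (BlockIdx size) (Fin n) ℂ
  Q_mul_Qinv : Q * Qinv = 1
  Qinv_mul_Q : Qinv * Q = 1
  eq_conj : A = Q * jordanMatrix size eig * Qinv

namespace JordanForm

variable {n : ℕ} {A : Matrix (Fin n) (Fin n) ℂ}

/-- The subspace `Q⁻¹ N` corresponding to `N` in Jordan coordinates. -/
noncomputable def pull (F : JordanForm A) (N : Submodule ℂ (Fin n → ℂ)) :
    Submodule ℂ (BlockIdx F.size → ℂ) :=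
  N.map F.Qinv.mulVecLin

/-- The size of the largest Jordan block with eigenvalue `z`. -/
noncomputable def maxSize (F : JordanForm A) (z : ℂ) : ℕ :=
  (Finset.univ.filter fun i => F.eig i = z).sup F.size

open Classical in
/-- The block sizes after expansion at the eigenvalues in `E`: each block with eigenvalue in `E`
whose size falls short of the largest one by more than one is expanded to one less than the
largest size; all other blocks stay as they are. -/
noncomputable def expandedSize (F : JordanForm A) (E : Set ℂ) (i : Fin F.u) : ℕ :=
  if F.eig i ∈ E then max (F.size i) (F.maxSize (F.eig i) - 1) else F.size i

/-- `N` is obtained, in the expansion of the Jordan matrix at `E`, from the block diagonal matrix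
`Z` with powers `k` and the change of variables `T`.  Here `T` is invertible, commutes with the
expanded Jordan matrix, and maps the first vector of block `j` to a combination of eigenvectors
whose rightmost block is `j`; and `Q⁻¹ N`, viewed in the expanded space, is `ker (Z T⁻¹)`. -/
def Represents (F : JordanForm A) (E : Set ℂ) (k : Fin F.u → ℕ)
    (T : Matrix (BlockIdx (F.expandedSize E)) (BlockIdx (F.expandedSize E)) ℂ)
    (N : Submodule ℂ (Fin n → ℂ)) : Prop :=
  IsUnit T ∧ Commute T (jordanMatrix (F.expandedSize E) F.eig) ∧
    (∀ (i j : Fin F.u) (hi : 0 < F.expandedSize E i) (hj : 0 < F.expandedSize E j),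
      j < i → T ⟨i, 0, hi⟩ ⟨j, 0, hj⟩ = 0) ∧
    (F.pull N).map (rowSelection F.size (F.expandedSize E))ᵀ.mulVecLin =
      LinearMap.ker (shiftMatrix (F.expandedSize E) k * T⁻¹).mulVecLin

/-- The length of the chain of `N` belonging to block `j`: the largest length `k` of a Jordan
chain `v, (J - λ) v, …, (J - λ) ^ (k - 1) v` in `Q⁻¹ N` whose eigenvector `(J - λ) ^ (k - 1) v`
has block `j` as the rightmost block on which it is nonzero (and `0` if there is none). -/
noncomputable def chainLength (F : JordanForm A) (N : Submodule ℂ (Fin n → ℂ))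
    (j : Fin F.u) : ℕ :=
  sSup {k | 0 < k ∧ ∃ v ∈ F.pull N, ∃ w : BlockIdx F.size → ℂ,
    w = ((jordanMatrix F.size F.eig - F.eig j • 1) ^ (k - 1)) *ᵥ v ∧
    (jordanMatrix F.size F.eig - F.eig j • 1) *ᵥ w = 0 ∧
    (∃ a, w ⟨j, a⟩ ≠ 0) ∧ ∀ i, j < i → ∀ a, w ⟨i, a⟩ = 0}

/-- Two invariant subspaces are of the same type when their chains belonging to each Jordan
block have the same length. -/
noncomputable def typeSetoid (F : JordanForm A) : Setoid (invariantLattice A) :=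
  Setoid.ker fun N => F.chainLength N.1

/-- The types of invariant subspaces. -/
abbrev InvType (F : JordanForm A) : Type := Quotient F.typeSetoid

/-- One type is below another when some subspace of the first type lies in some subspace of the
second type. -/
instance (F : JordanForm A) : LE F.InvType where
  le x y := ∃ N N' : invariantLattice A,
    N ≤ N' ∧ Quotient.mk F.typeSetoid N = x ∧ Quotient.mk F.typeSetoid N' = y

/-- The block diagonal matrices of powers of backward shifts, for the block structure expanded at
all eigenvalues, with powers at most the original block sizes. -/
abbrev ZMatrix (F : JordanForm A) : Type :=
  {Z : Matrix (BlockIdx (F.expandedSize Set.univ)) (BlockIdx (F.expandedSize Set.univ)) ℂ //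
    ∃ k ≤ F.size, Z = shiftMatrix (F.expandedSize Set.univ) k}

/-- The matrices `Z` are ordered by inclusion of their kernels. -/
instance (F : JordanForm A) : LE F.ZMatrix where
  le Z Z' := LinearMap.ker Z.1.mulVecLin ≤ LinearMap.ker Z'.1.mulVecLin

/-- Two invariant subspaces are of the same refined type when they are of the same type and
are not marked at the same eigenvalues. -/
noncomputable def refinedSetoid (F : JordanForm A) : Setoid (invariantLattice A) :=
  Setoid.ker fun N => (F.chainLength N.1, nonMarkedEigenvalues A N.1)

/-- The matrix `Z`, together with its block sizes, is the one constructed for `N`: the Jordan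
matrix is expanded exactly at the eigenvalues where `N` is not marked. -/
def Produces (F : JordanForm A) (N : Submodule ℂ (Fin n → ℂ))
    (Z : Σ s : Fin F.u → ℕ, Matrix (BlockIdx s) (BlockIdx s) ℂ) : Prop :=
  ∃ k ≤ F.size, (∃ T, F.Represents (nonMarkedEigenvalues A N) k T N) ∧
    Z = ⟨F.expandedSize (nonMarkedEigenvalues A N), shiftMatrix _ k⟩

/-- The explicit list of all matrices `Z`: the powers `k` are at most the block sizes, and blocks
may be expanded at an eigenvalue `z` when two of its blocks `i`, `j`, both of them with a power
below the block size, differ in size and in power by more than one, in the same direction. -/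
def zList (F : JordanForm A) : Set (Σ s : Fin F.u → ℕ, Matrix (BlockIdx s) (BlockIdx s) ℂ) :=
  {Z | ∃ k ≤ F.size, ∃ E : Set ℂ,
    (∀ z ∈ E, ∃ i j, F.eig i = z ∧ F.eig j = z ∧ k i < F.size i ∧ k j < F.size j ∧
      F.size i + 1 < F.size j ∧ k i + 1 < k j) ∧
    Z = ⟨F.expandedSize E, shiftMatrix _ k⟩}

/-- The powers `r` of hyperinvariant subspaces: among the blocks of each eigenvalue, listed from
larger to smaller, both the powers `r` and the differences `size - r` are non-increasing. -/
def hyperPowers (F : JordanForm A) : Sublattice (Fin F.u → ℕ) where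
  carrier := {r | r ≤ F.size ∧ ∀ i j, i ≤ j → F.eig i = F.eig j →
    r j ≤ r i ∧ F.size j - r j ≤ F.size i - r i}
  supClosed' := by
    rintro r ⟨hr, hr'⟩ q ⟨hq, hq'⟩
    refine ⟨sup_le hr hq, fun i j hij he => ?_⟩
    have h1 := hr' i j hij he
    have h2 := hq' i j hij he
    simp only [Pi.sup_apply]
    omega
  infClosed' := by
    rintro r ⟨hr, hr'⟩ q ⟨hq, hq'⟩
    refine ⟨inf_le_left.trans hr, fun i j hij he => ?_⟩
    have h1 := hr' i j hij he
    have h2 := hq' i j hij he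
    simp only [Pi.inf_apply]
    omega

end JordanForm

/-! All block structures are placed in one space of families of sequences, so that expanding blocks
merely relaxes the bound on positions. The positions are ordered first by their place in the block
and then by the block (`pos`). A nonzero vector supported on the blocks of one eigenvalue λ has as
its lead the largest position of its support. On such vectors A - λ is a shift, which lowers a lead
by one inside its block. Hence the leads in an invariant subspace N fill the first k_j positions of
each block j, and k_j is the chain length of the statement (`chainLength_eq`). By elimination
(`exists_reduction`), an invariant subspace of N with the same leads is all of N (`le_of_hasLead`).

A matrix T as in the statement is triangular for this order with nonzero diagonal, so it preserves
leads, and T(ker Z) has the leads of ker Z, namely those given by k. This makes k unique. For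
existence, pick v_j in N with lead (j, k_j - 1) and let the columns of T in block j be the shifts of
v_j, downwards and upwards (`chainMatrix`). The upward shifts must fit into the blocks: v_j has to
be deep, that is, a + s_j < s_i + k_j at every position (i, a) of its support. This is automatic
when the sizes of each eigenvalue differ by at most one, and expansion brings about exactly that.

Without expansion, N is marked at λ if and only if the v_j for λ can be chosen deep
(`hasDeepChains_of_isMarked`, `isMarked_of_represents`). If they cannot, reducing v_j modulo N
exposes two blocks with the gap of item 4 (`exists_gap`). Conversely, copying the end of the long
block's chain into the short block gives a subspace without deep chains (`exists_of_gaps`).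

Smaller or larger powers are realized by keeping T and changing k. Hyperinvariance allows projecting
to single blocks, which forces N to consist of the initial positions of each block; the conditions
on r then express which entries of a matrix commuting with J can be nonzero (`commute_entry`). -/

/-! ### Block sequences, leads and profiles. -/

/-- Families of sequences, one for each of `u` blocks. The space of a block structure `s` is the
space of those families that vanish from position `s i` on in each block `i`. -/
abbrev BlockSeq (u : ℕ) : Type := Fin u → ℕ → ℂ

namespace BlockSeq

variable {u : ℕ}

/-- The Jordan matrix with infinite blocks. -/
def jordan (μ : Fin u → ℂ) : BlockSeq u →ₗ[ℂ] BlockSeq u where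
  toFun v i a := μ i * v i a + v i (a + 1)
  map_add' v w := by funext i a; simp only [Pi.add_apply]; ring
  map_smul' c v := by funext i a; simp only [Pi.smul_apply, smul_eq_mul, RingHom.id_apply]; ring

@[simp] lemma jordan_apply (μ : Fin u → ℂ) (v : BlockSeq u) (i : Fin u) (a : ℕ) :
    jordan μ v i a = μ i * v i a + v i (a + 1) := rfl

/-- The families that vanish from position `s i` on in each block `i`. -/
def bounded (s : Fin u → ℕ) : Submodule ℂ (BlockSeq u) where
  carrier := {v | ∀ i a, s i ≤ a → v i a = 0}
  add_mem' {v w} hv hw i a h := by simp [hv i a h, hw i a h]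
  zero_mem' _ _ _ := rfl
  smul_mem' c v hv i a h := by simp [hv i a h]

lemma mem_bounded {s : Fin u → ℕ} {v : BlockSeq u} :
    v ∈ bounded s ↔ ∀ i a, s i ≤ a → v i a = 0 := Iff.rfl

lemma lt_of_mem_bounded {s : Fin u → ℕ} {v : BlockSeq u} (hv : v ∈ bounded s) {i : Fin u} {a : ℕ}
    (h : v i a ≠ 0) : a < s i := by
  by_contra! h'
  exact h (hv i a h')

lemma bounded_mono {s t : Fin u → ℕ} (h : s ≤ t) : bounded s ≤ bounded t :=
  fun _ hv i a ha => hv i a ((h i).trans ha)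

lemma jordan_mem_bounded {s : Fin u → ℕ} (μ : Fin u → ℂ) {v : BlockSeq u} (hv : v ∈ bounded s) :
    jordan μ v ∈ bounded s := fun i a h => by
  simp [hv i a h, hv i (a + 1) (by omega)]

/-- The numbering of the positions of all blocks, by the position and then by the block. -/
def pos (i : Fin u) (a : ℕ) : ℕ := a * u + i

lemma pos_le_iff {i j : Fin u} {a b : ℕ} : pos i b ≤ pos j a ↔ b < a ∨ b = a ∧ i ≤ j := by
  have hi := i.2
  have hj := j.2
  unfold pos
  rcases lt_trichotomy b a with h | h | h
  · have h' : (b + 1) * u ≤ a * u := Nat.mul_le_mul_right u h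
    rw [add_one_mul] at h'
    exact iff_of_true (by omega) (Or.inl h)
  · subst h
    rw [Nat.add_le_add_iff_left, Fin.le_def]
    omega
  · have h' : (a + 1) * u ≤ b * u := Nat.mul_le_mul_right u h
    rw [add_one_mul] at h'
    exact iff_of_false (by omega) (by omega)

lemma pos_inj {i j : Fin u} {a b : ℕ} : pos i b = pos j a ↔ i = j ∧ b = a := by
  constructor
  · intro h
    have h1 := pos_le_iff.1 h.le
    have h2 := pos_le_iff.1 h.ge
    rcases h1 with h1 | ⟨h1, h1'⟩
    · omega
    · rcases h2 with h2 | ⟨h2, h2'⟩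
      · omega
      · exact ⟨le_antisymm h1' h2', h1⟩
  · rintro ⟨rfl, rfl⟩
    rfl

/-- The family is supported on the blocks with eigenvalue `z`. -/
def SupportedAt (μ : Fin u → ℂ) (z : ℂ) (v : BlockSeq u) : Prop :=
  ∀ i a, v i a ≠ 0 → μ i = z

/-- The projection to the blocks with eigenvalue `z`. -/
noncomputable def component (μ : Fin u → ℂ) (z : ℂ) : BlockSeq u →ₗ[ℂ] BlockSeq u where
  toFun v i a := by classical exact if μ i = z then v i a else 0
  map_add' v w := by funext i a; simp only [Pi.add_apply]; split_ifs <;> simp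
  map_smul' c v := by
    funext i a; simp only [Pi.smul_apply, smul_eq_mul, RingHom.id_apply]; split_ifs <;> simp

open Classical in
lemma component_apply (μ : Fin u → ℂ) (z : ℂ) (v : BlockSeq u) (i : Fin u) (a : ℕ) :
    component μ z v i a = if μ i = z then v i a else 0 := rfl

lemma supportedAt_component (μ : Fin u → ℂ) (z : ℂ) (v : BlockSeq u) :
    SupportedAt μ z (component μ z v) := fun i a h => by
  by_contra h'
  simp [component_apply, h'] at h

lemma component_eq_self {μ : Fin u → ℂ} {z : ℂ} {v : BlockSeq u} (h : SupportedAt μ z v) :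
    component μ z v = v := by
  funext i a
  by_cases h' : μ i = z
  · simp [component_apply, h']
  · have : v i a = 0 := by_contra fun h'' => h' (h i a h'')
    simp [component_apply, this]

lemma component_eq_zero {μ : Fin u → ℂ} {z z' : ℂ} {v : BlockSeq u} (h : SupportedAt μ z' v)
    (hz : z' ≠ z) : component μ z v = 0 := by
  funext i a
  by_cases h' : μ i = z
  · have : v i a = 0 := by_contra fun h'' => hz ((h i a h'').symm.trans h')
    simp [component_apply, this]
  · simp [component_apply, h']

open Classical in
lemma sum_component (μ : Fin u → ℂ) (v : BlockSeq u) :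
    ∑ z ∈ Finset.univ.image μ, component μ z v = v := by
  funext i a
  simp [Finset.sum_apply, component_apply]

/-- The vector of the standard basis at position `a` of block `j`. -/
def unit (j : Fin u) (a : ℕ) : BlockSeq u := fun i b => if i = j ∧ b = a then 1 else 0

lemma unit_apply (i j : Fin u) (a b : ℕ) : unit j a i b = if i = j ∧ b = a then 1 else 0 := rfl

/-- `a` is the largest position at which `v` is nonzero, `j` is the rightmost block where this
position occurs, and `v` is supported on the blocks with the same eigenvalue as block `j`. -/
structure HasLead (μ : Fin u → ℂ) (j : Fin u) (a : ℕ) (v : BlockSeq u) : Prop where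
  ne : v j a ≠ 0
  eig : ∀ i b, v i b ≠ 0 → μ i = μ j
  le : ∀ i b, v i b ≠ 0 → pos i b ≤ pos j a

lemma HasLead.unique {μ : Fin u → ℂ} {i j : Fin u} {a b : ℕ} {v : BlockSeq u}
    (h : HasLead μ j a v) (h' : HasLead μ i b v) : i = j ∧ b = a :=
  pos_inj.1 (le_antisymm (h.le _ _ h'.ne) (h'.le _ _ h.ne))

lemma hasLead_unit (μ : Fin u → ℂ) (j : Fin u) (a : ℕ) : HasLead μ j a (unit j a) where
  ne := by simp [unit]
  eig i b h := by
    have : i = j ∧ b = a := by by_contra h'; simp [unit, h'] at h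
    rw [this.1]
  le i b h := by
    have : i = j ∧ b = a := by by_contra h'; simp [unit, h'] at h
    rw [this.1, this.2]

lemma exists_hasLead {μ : Fin u → ℂ} {z : ℂ} {s : Fin u → ℕ} {v : BlockSeq u}
    (hs : v ∈ bounded s) (hz : SupportedAt μ z v) (hv : v ≠ 0) :
    ∃ j a, μ j = z ∧ HasLead μ j a v := by
  classical
  let S : Finset (Σ i : Fin u, Fin (s i)) := Finset.univ.filter fun p => v p.1 p.2 ≠ 0
  have hS : S.Nonempty := by
    by_contra h
    rw [Finset.not_nonempty_iff_eq_empty] at h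
    apply hv
    funext i a
    by_contra h'
    have : (⟨i, a, lt_of_mem_bounded hs h'⟩ : Σ i : Fin u, Fin (s i)) ∈ S := by
      simp only [S, Finset.mem_filter, Finset.mem_univ, true_and]; exact h'
    simp [h] at this
  obtain ⟨⟨j, a⟩, hp, hmax⟩ := S.exists_max_image (fun p => pos p.1 p.2) hS
  have hp' : v j a ≠ 0 := by simpa [S] using hp
  have hj := hz _ _ hp'
  refine ⟨j, a, hj, hp', fun i b h => (hz _ _ h).trans hj.symm, fun i b h => ?_⟩
  exact hmax ⟨i, b, lt_of_mem_bounded hs h⟩ (by simpa [S] using h)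

/-- The positions of leading terms of vectors of `N` are the first `k j` ones in each block `j`. -/
def HasProfile (μ : Fin u → ℂ) (N : Submodule ℂ (BlockSeq u)) (k : Fin u → ℕ) : Prop :=
  ∀ j a, (∃ v ∈ N, HasLead μ j a v) ↔ a < k j

lemma HasProfile.unique {μ : Fin u → ℂ} {N : Submodule ℂ (BlockSeq u)} {k l : Fin u → ℕ}
    (h : HasProfile μ N k) (h' : HasProfile μ N l) : k = l := by
  funext j
  have h1 := fun a => (h j a).symm.trans (h' j a)
  have h2 := h1 (k j)
  have h3 := h1 (l j)
  omega

lemma HasProfile.mono {μ : Fin u → ℂ} {N M : Submodule ℂ (BlockSeq u)} {k l : Fin u → ℕ}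
    (h : HasProfile μ N k) (h' : HasProfile μ M l) (hNM : N ≤ M) : k ≤ l := fun j => by
  by_contra! hlt
  obtain ⟨v, hv, hl⟩ := (h j (l j)).2 hlt
  exact lt_irrefl _ ((h' j (l j)).1 ⟨v, hNM hv, hl⟩)

lemma HasProfile.le {μ : Fin u → ℂ} {N : Submodule ℂ (BlockSeq u)} {k s : Fin u → ℕ}
    (h : HasProfile μ N k) (hs : N ≤ bounded s) : k ≤ s := fun j => by
  by_contra! hlt
  obtain ⟨v, hv, hl⟩ := (h j (s j)).2 hlt
  exact hl.ne (hs hv j _ le_rfl)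

/-- Gaussian elimination from the top position down. An entry below `k` is cleared with a vector of
`M` that has its lead there; an entry at or beyond `k` is discarded, since no agreement is demanded
there. -/
lemma exists_reduction {μ : Fin u → ℂ} {M : Submodule ℂ (BlockSeq u)} {k : Fin u → ℕ}
    (hM : ∀ j a, a < k j → ∃ v ∈ M, HasLead μ j a v) (z : ℂ) (p : ℕ) :
    ∀ y : BlockSeq u, SupportedAt μ z y → (∀ i b, y i b ≠ 0 → pos i b < p) →
      ∃ w ∈ M, SupportedAt μ z w ∧ (∀ i b, w i b ≠ 0 → pos i b < p) ∧
        ∀ i b, b < k i → y i b = w i b := by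
  induction p with
  | zero =>
    intro y _ hy
    refine ⟨0, M.zero_mem, fun i b h => absurd rfl h, fun i b h => absurd rfl h, fun i b _ => ?_⟩
    by_contra h
    exact absurd (hy i b h) (by omega)
  | succ p ih =>
    intro y hz hy
    by_cases hex : ∃ j a, pos j a = p ∧ a < k j ∧ y j a ≠ 0
    · obtain ⟨j, a, hp, ha, hya⟩ := hex
      obtain ⟨v, hvM, hv⟩ := hM j a ha
      have hj := hz _ _ hya
      set c := y j a / v j a with hc
      have hvz : SupportedAt μ z v := fun i b h => (hv.eig i b h).trans hj
      obtain ⟨w, hwM, hwz, hwp, hw⟩ := ih (y - c • v)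
        (fun i b h => by
          by_cases h1 : y i b = 0
          · by_cases h2 : v i b = 0
            · simp [h1, h2] at h
            · exact hvz _ _ h2
          · exact hz _ _ h1)
        (fun i b h => by
          have h3 : pos i b ≤ p := by
            by_cases h1 : y i b = 0
            · by_cases h2 : v i b = 0
              · simp [h1, h2] at h
              · exact hp ▸ hv.le _ _ h2
            · exact Nat.lt_succ_iff.1 (hy _ _ h1)
          refine lt_of_le_of_ne h3 fun h4 => h ?_
          obtain ⟨rfl, rfl⟩ := pos_inj.1 (h4.trans hp.symm)
          simp [hc, hv.ne])
      refine ⟨w + c • v, M.add_mem hwM (M.smul_mem c hvM), fun i b h => ?_, fun i b h => ?_,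
        fun i b h => ?_⟩
      · by_cases h1 : w i b = 0
        · by_cases h2 : v i b = 0
          · simp [h1, h2] at h
          · exact hvz _ _ h2
        · exact hwz _ _ h1
      · by_cases h1 : w i b = 0
        · by_cases h2 : v i b = 0
          · simp [h1, h2] at h
          · have := hv.le _ _ h2
            omega
        · have := hwp _ _ h1
          omega
      · have := hw i b h
        simp only [Pi.sub_apply, Pi.smul_apply] at this
        simp only [Pi.add_apply, Pi.smul_apply, ← this]
        ring
    · push Not at hex
      obtain ⟨w, hwM, hwz, hwp, hw⟩ := ih (fun i b => if pos i b = p then 0 else y i b)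
        (fun i b h => hz i b fun h' => h (by simp [h']))
        (fun i b h => by
          have h1 : pos i b ≠ p := fun h' => h (by simp [h'])
          have h2 := hy i b fun h' => h (by simp [h'])
          omega)
      refine ⟨w, hwM, hwz, fun i b h => (hwp i b h).trans (Nat.lt_succ_self p), fun i b h => ?_⟩
      rw [← hw i b h]
      split_ifs with h1
      · exact hex i b h1 h
      · rfl

lemma exists_pos_bound {s : Fin u → ℕ} {y : BlockSeq u} (hy : y ∈ bounded s) :
    ∃ p, ∀ i b, y i b ≠ 0 → pos i b < p := by
  refine ⟨(Finset.univ.sup s) * u + u, fun i b h => ?_⟩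
  have h1 := lt_of_mem_bounded hy h
  have h2 : s i ≤ Finset.univ.sup s := Finset.le_sup (Finset.mem_univ i)
  have h3 : b * u ≤ (Finset.univ.sup s) * u := Nat.mul_le_mul_right u (by omega)
  have := i.2
  unfold pos
  omega

/-- A submodule that has as many leading terms as a larger one is equal to it. -/
lemma le_of_hasLead {μ : Fin u → ℂ} {s : Fin u → ℕ} {N M : Submodule ℂ (BlockSeq u)}
    {k : Fin u → ℕ} (hMN : M ≤ N) (hs : N ≤ bounded s)
    (hcomp : ∀ z, ∀ v ∈ N, component μ z v ∈ N)
    (hN : ∀ j a, (∃ v ∈ N, HasLead μ j a v) → a < k j)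
    (hM : ∀ j a, a < k j → ∃ v ∈ M, HasLead μ j a v) : N ≤ M := by
  classical
  intro y hy
  rw [← sum_component μ y]
  refine M.sum_mem fun z _ => ?_
  have hyN := hcomp z y hy
  obtain ⟨p, hp⟩ := exists_pos_bound (hs hyN)
  obtain ⟨w, hwM, hwz, -, hw⟩ :=
    exists_reduction hM z p _ (supportedAt_component μ z y) hp
  suffices component μ z y - w = 0 by rwa [sub_eq_zero.1 this]
  have hd : component μ z y - w ∈ N := N.sub_mem hyN (hMN hwM)
  by_contra hne
  -- The difference lies in `N`, so its lead would be at a position below `k`, where the two vectors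
  -- agree.
  obtain ⟨j, a, -, hl⟩ := exists_hasLead (μ := μ) (z := z) (hs hd) (fun i b h => by
    by_cases h1 : w i b = 0
    · refine supportedAt_component μ z y i b fun h2 => h ?_
      simp [h1, h2]
    · exact hwz _ _ h1) hne
  refine hl.ne ?_
  simp [hw j a (hN j a ⟨_, hd, hl⟩)]

/-- On vectors supported at `z` the map `jordan μ - z` is the plain shift. -/
lemma shift_mem {μ : Fin u → ℂ} {N : Submodule ℂ (BlockSeq u)}
    (hN : ∀ v ∈ N, jordan μ v ∈ N) {z : ℂ} {v : BlockSeq u} (hv : v ∈ N)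
    (hz : SupportedAt μ z v) (p : ℕ) : (fun i b => v i (b + p)) ∈ N := by
  induction p with
  | zero => exact hv
  | succ p ih =>
    have h := N.sub_mem (hN _ ih) (N.smul_mem z ih)
    convert h using 1
    funext i b
    simp only [Pi.sub_apply, jordan_apply, Pi.smul_apply, smul_eq_mul]
    rw [show b + (p + 1) = b + 1 + p by ring]
    by_cases h0 : v i (b + p) = 0
    · simp [h0]
    · rw [hz _ _ h0]; ring

lemma HasLead.shift {μ : Fin u → ℂ} {j : Fin u} {a p : ℕ} {v : BlockSeq u}
    (h : HasLead μ j (a + p) v) : HasLead μ j a (fun i b => v i (b + p)) where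
  ne := h.ne
  eig i b hb := h.eig i _ hb
  le i b hb := by
    have := pos_le_iff.1 (h.le i _ hb)
    rw [pos_le_iff]
    omega

lemma HasLead.supportedAt {μ : Fin u → ℂ} {j : Fin u} {a : ℕ} {v : BlockSeq u}
    (h : HasLead μ j a v) : SupportedAt μ (μ j) v := h.eig

/-- An invariant submodule has a profile. -/
lemma hasProfile_sSup {μ : Fin u → ℂ} {s : Fin u → ℕ} {N : Submodule ℂ (BlockSeq u)}
    (hN : ∀ v ∈ N, jordan μ v ∈ N) (hs : N ≤ bounded s) :
    HasProfile μ N fun j => sSup {k | 0 < k ∧ ∃ v ∈ N, HasLead μ j (k - 1) v} := by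
  intro j a
  have hbdd : BddAbove {k | 0 < k ∧ ∃ v ∈ N, HasLead μ j (k - 1) v} := by
    refine ⟨s j, ?_⟩
    rintro k ⟨hk, v, hv, hl⟩
    have := lt_of_mem_bounded (hs hv) hl.ne
    omega
  constructor
  · rintro ⟨v, hv, hl⟩
    exact Nat.lt_of_succ_le (le_csSup hbdd ⟨Nat.succ_pos a, v, hv, hl⟩)
  · intro ha
    dsimp only at ha
    have hne : {k | 0 < k ∧ ∃ v ∈ N, HasLead μ j (k - 1) v}.Nonempty := by
      by_contra h
      rw [Set.not_nonempty_iff_eq_empty] at h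
      simp [h] at ha
    obtain ⟨h0, v, hv, hl⟩ := Nat.sSup_mem hne hbdd
    set m := sSup {k | 0 < k ∧ ∃ v ∈ N, HasLead μ j (k - 1) v}
    -- The highest lead of the block is attained; shifting that vector down by `p` produces every
    -- lower lead.
    obtain ⟨p, hp⟩ : ∃ p, m - 1 = a + p := ⟨m - 1 - a, by omega⟩
    rw [hp] at hl
    exact ⟨_, shift_mem hN hv hl.supportedAt p, hl.shift⟩

end BlockSeq

/-! ### Jordan coordinates of an endomorphism. -/

namespace BlockSeq

variable {u : ℕ}

/-- `φ` identifies the endomorphism `f` with the Jordan matrix with block sizes `s` and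
eigenvalues `μ`. -/
structure IsCoord {V : Type*} [AddCommGroup V] [Module ℂ V] (f : Module.End ℂ V)
    (s : Fin u → ℕ) (μ : Fin u → ℂ) (φ : V →ₗ[ℂ] BlockSeq u) : Prop where
  inj : Function.Injective φ
  range_eq : LinearMap.range φ = bounded s
  map : ∀ v, φ (f v) = jordan μ (φ v)

namespace IsCoord

variable {V : Type*} [AddCommGroup V] [Module ℂ V] {f : Module.End ℂ V}
  {s : Fin u → ℕ} {μ : Fin u → ℂ} {φ : V →ₗ[ℂ] BlockSeq u}

lemma mem_bounded (h : IsCoord f s μ φ) (v : V) : φ v ∈ bounded s :=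
  h.range_eq ▸ LinearMap.mem_range_self φ v

lemma exists_eq (h : IsCoord f s μ φ) {y : BlockSeq u} (hy : y ∈ bounded s) : ∃ v, φ v = y :=
  LinearMap.mem_range.1 (h.range_eq ▸ hy)

lemma map_sub (h : IsCoord f s μ φ) (z : ℂ) (v : V) (i : Fin u) (a : ℕ) :
    φ ((f - z • 1) v) i a = (μ i - z) * φ v i a + φ v i (a + 1) := by
  simp only [LinearMap.sub_apply, LinearMap.smul_apply, Module.End.one_apply, _root_.map_sub,
    map_smul, h.map, Pi.sub_apply, Pi.smul_apply, jordan_apply, smul_eq_mul]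
  ring

/-- Blocks do not interact, so nothing is required of the entries of `v` in other blocks. -/
lemma pow_apply (h : IsCoord f s μ φ) {z : ℂ} {i : Fin u} (hi : μ i = z) (p : ℕ) (v : V) (a : ℕ) :
    φ (((f - z • 1) ^ p) v) i a = φ v i (a + p) := by
  induction p generalizing a with
  | zero => rfl
  | succ p ih =>
    rw [pow_succ', Module.End.mul_apply, h.map_sub, hi, sub_self, zero_mul, zero_add, ih,
      show a + 1 + p = a + (p + 1) by omega]

/-- On a block with another eigenvalue `f - z` is triangular with diagonal `μ i - z ≠ 0`, hence
injective; the entries are recovered from the end of the block backwards. -/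
lemma eq_zero_of_pow (h : IsCoord f s μ φ) {z : ℂ} {i : Fin u} (hi : μ i ≠ z) (p : ℕ) (v : V)
    (hv : ∀ a, φ (((f - z • 1) ^ p) v) i a = 0) (a : ℕ) : φ v i a = 0 := by
  induction p generalizing v a with
  | zero => exact hv a
  | succ p ih =>
    have h1 := ih ((f - z • 1) v) (by simpa only [pow_succ, Module.End.mul_apply] using hv)
    have key : ∀ t a, s i ≤ a + t → φ v i a = 0 := by
      intro t
      induction t with
      | zero => exact fun a ha => h.mem_bounded v i a ha
      | succ t iht =>
        intro a ha
        have h2 := h1 a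
        rw [h.map_sub, iht (a + 1) (by omega), add_zero] at h2
        exact (mul_eq_zero.1 h2).resolve_left (sub_ne_zero.2 hi)
    exact key (s i) a (by omega)

lemma map_pow (h : IsCoord f s μ φ) {z : ℂ} {v : V} (hz : SupportedAt μ z (φ v)) (p : ℕ) :
    φ (((f - z • 1) ^ p) v) = fun i a => φ v i (a + p) := by
  induction p with
  | zero => rfl
  | succ p ih =>
    funext i a
    rw [pow_succ', Module.End.mul_apply, h.map_sub, ih]
    dsimp only
    by_cases h0 : φ v i (a + p) = 0
    · rw [h0, mul_zero, zero_add, show a + 1 + p = a + (p + 1) by omega]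
    · rw [hz _ _ h0, sub_self, zero_mul, zero_add, show a + 1 + p = a + (p + 1) by omega]

/-- The left side does not depend on the coordinates. This is what allows supports in two different
Jordan bases to be compared. -/
lemma pow_eq_zero_iff (h : IsCoord f s μ φ) {z : ℂ} {p : ℕ} {v : V} :
    ((f - z • 1) ^ p) v = 0 ↔ ∀ i a, φ v i a ≠ 0 → μ i = z ∧ a < p := by
  constructor
  · intro h0 i a hne
    have hi : μ i = z := by
      by_contra hi
      exact hne (h.eq_zero_of_pow hi p v (fun a => by simp [h0]) a)
    refine ⟨hi, ?_⟩
    by_contra! hp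
    have := h.pow_apply hi p v (a - p)
    rw [h0, Nat.sub_add_cancel hp, map_zero] at this
    exact hne this.symm
  · intro h0
    apply h.inj
    rw [map_zero, h.map_pow fun i a h' => (h0 i a h').1]
    funext i a
    by_contra hne
    have := (h0 _ _ hne).2
    omega

lemma mem_maxGenEigenspace_iff (h : IsCoord f s μ φ) {z : ℂ} {v : V} :
    v ∈ f.maxGenEigenspace z ↔ SupportedAt μ z (φ v) := by
  rw [Module.End.mem_maxGenEigenspace]
  constructor
  · rintro ⟨k, hk⟩ i a hne
    exact (h.pow_eq_zero_iff.1 hk i a hne).1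
  · intro hz
    refine ⟨Finset.univ.sup s, h.pow_eq_zero_iff.2 fun i a hne => ⟨hz i a hne, ?_⟩⟩
    exact (lt_of_mem_bounded (h.mem_bounded v) hne).trans_le (Finset.le_sup (Finset.mem_univ i))

/-- An invariant subspace is the sum of its intersections with the generalized eigenspaces. Leads
are defined one eigenvalue at a time, and by this decomposition they account for all of `N`. -/
lemma component_mem [FiniteDimensional ℂ V] (h : IsCoord f s μ φ) {N : Submodule ℂ V}
    (hN : N ∈ f.invtSubmodule) (z : ℂ) (y : BlockSeq u) (hy : y ∈ N.map φ) :
    component μ z y ∈ N.map φ := by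
  have hN' : ∀ x ∈ N, f x ∈ N := fun x hx => hN hx
  have htop : (⨆ z : ℂ, f.maxGenEigenspace z) = ⊤ := Module.End.iSup_maxGenEigenspace_eq_top f
  have hdec := Submodule.eq_iSup_inf_genEigenspace (f := f) (p := N) ⊤ hN' htop
  obtain ⟨v, hv, rfl⟩ := hy
  rw [hdec] at hv
  induction hv using Submodule.iSup_induction' with
  | mem w x hx =>
    have hx2 := h.mem_maxGenEigenspace_iff.1 hx.2
    by_cases hw : w = z
    · rw [component_eq_self (hw ▸ hx2)]
      exact Submodule.mem_map_of_mem hx.1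
    · rw [component_eq_zero hx2 hw]
      exact Submodule.zero_mem _
  | zero => simp
  | add x y _ _ h1 h2 =>
    rw [map_add, map_add]
    exact Submodule.add_mem _ h1 h2

lemma jordan_mem (h : IsCoord f s μ φ) {N : Submodule ℂ V} (hN : N ∈ f.invtSubmodule)
    (y : BlockSeq u) (hy : y ∈ N.map φ) : jordan μ y ∈ N.map φ := by
  obtain ⟨v, hv, rfl⟩ := hy
  rw [← h.map]
  exact Submodule.mem_map_of_mem (hN hv)

lemma mem_invtSubmodule (h : IsCoord f s μ φ) {N : Submodule ℂ V}
    (hN : ∀ y ∈ N.map φ, jordan μ y ∈ N.map φ) : N ∈ f.invtSubmodule := by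
  intro v hv
  have := hN _ (Submodule.mem_map_of_mem hv)
  rw [← h.map] at this
  obtain ⟨w, hw, hwv⟩ := this
  rw [Submodule.mem_comap, ← h.inj hwv]
  exact hw

lemma map_le (h : IsCoord f s μ φ) (N : Submodule ℂ V) : N.map φ ≤ bounded s :=
  h.range_eq ▸ LinearMap.map_le_range

lemma map_comap (h : IsCoord f s μ φ) {N : Submodule ℂ (BlockSeq u)} (hN : N ≤ bounded s) :
    (N.comap φ).map φ = N :=
  Submodule.map_comap_eq_of_le (h.range_eq ▸ hN)

/-- Jordan chains whose eigenvector has a given rightmost block, in terms of leading terms. -/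
lemma exists_chain_iff (h : IsCoord f s μ φ) {N : Submodule ℂ V} {j : Fin u} {k : ℕ} (hk : 0 < k) :
    (∃ v ∈ N, (f - μ j • 1) (((f - μ j • 1) ^ (k - 1)) v) = 0 ∧
      (∃ a, φ (((f - μ j • 1) ^ (k - 1)) v) j a ≠ 0) ∧
      ∀ i, j < i → ∀ a, φ (((f - μ j • 1) ^ (k - 1)) v) i a = 0) ↔
    ∃ y ∈ N.map φ, HasLead μ j (k - 1) y := by
  constructor
  · rintro ⟨v, hv, h0, ⟨a, ha⟩, hr⟩
    rw [← Module.End.mul_apply, ← pow_succ', Nat.sub_add_cancel hk] at h0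
    have h1 := h.pow_eq_zero_iff.1 h0
    rw [h.pow_apply rfl] at ha
    have h2 := (h1 _ _ ha).2
    obtain rfl : a = 0 := by omega
    rw [zero_add] at ha
    refine ⟨φ v, Submodule.mem_map_of_mem hv, ha, fun i b hb => (h1 i b hb).1, fun i b hb => ?_⟩
    have h3 := h1 i b hb
    rw [pos_le_iff]
    by_contra! h4
    have h5 : b = k - 1 := by omega
    have h6 := hr i (h4.2 h5) 0
    rw [h.pow_apply h3.1, zero_add, ← h5] at h6
    exact hb h6
  · rintro ⟨_, ⟨v, hv, rfl⟩, hl⟩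
    have hlt : ∀ i b, φ v i b ≠ 0 → b < k := fun i b hb => by
      have := pos_le_iff.1 (hl.le i b hb)
      omega
    refine ⟨v, hv, ?_, ⟨0, ?_⟩, fun i hij a => ?_⟩
    · rw [← Module.End.mul_apply, ← pow_succ', Nat.sub_add_cancel hk]
      exact h.pow_eq_zero_iff.2 fun i b hb => ⟨hl.eig i b hb, hlt i b hb⟩
    · rw [h.pow_apply rfl, zero_add]
      exact hl.ne
    · by_cases hi : μ i = μ j
      · rw [h.pow_apply hi]
        by_contra hne
        have := pos_le_iff.1 (hl.le _ _ hne)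
        omega
      · have hz : ((f - μ j • 1 : Module.End ℂ V) ^ 1) (((f - μ j • 1) ^ (k - 1)) v) = 0 := by
          rw [← Module.End.mul_apply, ← pow_add, show 1 + (k - 1) = k by omega]
          exact h.pow_eq_zero_iff.2 fun i b hb => ⟨hl.eig i b hb, hlt i b hb⟩
        by_contra hne
        exact hi (h.pow_eq_zero_iff.1 hz i a hne).1

end IsCoord

/-! ### Finite vectors and the matrices J and Z in sequence form. -/

/-- The extension of a vector by zero. -/
def ext (s : Fin u → ℕ) : (BlockIdx s → ℂ) →ₗ[ℂ] BlockSeq u where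
  toFun x i a := if h : a < s i then x ⟨i, a, h⟩ else 0
  map_add' x y := by funext i a; simp only [Pi.add_apply]; split_ifs <;> simp
  map_smul' c x := by
    funext i a; simp only [Pi.smul_apply, RingHom.id_apply]; split_ifs <;> simp

lemma ext_apply (s : Fin u → ℕ) (x : BlockIdx s → ℂ) (i : Fin u) (a : ℕ) :
    ext s x i a = if h : a < s i then x ⟨i, a, h⟩ else 0 := rfl

lemma ext_apply_of_lt {s : Fin u → ℕ} (x : BlockIdx s → ℂ) {i : Fin u} {a : ℕ} (h : a < s i) :
    ext s x i a = x ⟨i, a, h⟩ := by simp [ext_apply, h]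

lemma ext_apply_fin {s : Fin u → ℕ} (x : BlockIdx s → ℂ) (p : BlockIdx s) :
    ext s x p.1 p.2 = x p := by simp [ext_apply]

lemma ext_single {s : Fin u → ℕ} (p : BlockIdx s) : ext s (Pi.single p 1) = unit p.1 p.2 := by
  obtain ⟨j, c, hc⟩ := p
  funext i a
  rw [ext_apply, unit_apply]
  by_cases hia : i = j ∧ a = c
  · obtain ⟨rfl, rfl⟩ := hia
    simp [hc]
  · rw [if_neg hia]
    split_ifs with h
    · rw [Pi.single_apply, if_neg]
      intro h'
      rw [Sigma.mk.injEq] at h'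
      obtain ⟨rfl, h'⟩ := h'
      exact hia ⟨rfl, by simpa using h'⟩
    · rfl

lemma blockDiagonal'_mulVec {s : Fin u → ℕ} (M : ∀ i, Matrix (Fin (s i)) (Fin (s i)) ℂ)
    (x : BlockIdx s → ℂ) (i : Fin u) (a : Fin (s i)) :
    (blockDiagonal' M *ᵥ x) ⟨i, a⟩ = ∑ b, M i a b * x ⟨i, b⟩ := by
  simp only [mulVec, dotProduct, Fintype.sum_sigma]
  rw [Finset.sum_eq_single i]
  · simp
  · intro j _ hj
    exact Finset.sum_eq_zero fun b _ => by rw [blockDiagonal'_apply_ne _ _ _ hj.symm, zero_mul]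
  · simp

lemma backwardShift_pow_apply (m k : ℕ) (a b : Fin m) :
    (backwardShift m ^ k) a b = if (b : ℕ) = a + k then 1 else 0 := by
  induction k generalizing b with
  | zero => simp [Matrix.one_apply, Fin.ext_iff, eq_comm]
  | succ k ih =>
    rw [pow_succ, Matrix.mul_apply]
    simp only [ih, ite_mul, one_mul, zero_mul]
    by_cases h : (a : ℕ) + k < m
    · rw [Finset.sum_eq_single ⟨a + k, h⟩]
      · simp [backwardShift, add_assoc]
      · intro c _ hc
        rw [if_neg]
        exact fun h' => hc (Fin.ext h')
      · simp
    · rw [Finset.sum_eq_zero, if_neg]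
      · have := b.2
        omega
      · intro c _
        rw [if_neg]
        have := c.2
        omega

lemma sum_ite_mul_eq {s : Fin u → ℕ} (x : BlockIdx s → ℂ) (i : Fin u) (c : ℕ) :
    ∑ b : Fin (s i), (if (b : ℕ) = c then 1 else 0) * x ⟨i, b⟩ = ext s x i c := by
  rw [ext_apply]
  split_ifs with h
  · rw [Finset.sum_eq_single ⟨c, h⟩]
    · simp
    · intro b _ hb
      rw [if_neg fun h' => hb (Fin.ext h'), zero_mul]
    · simp
  · refine Finset.sum_eq_zero fun b _ => ?_
    rw [if_neg, zero_mul]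
    have := b.2
    omega

lemma shiftMatrix_mulVec (s k : Fin u → ℕ) (x : BlockIdx s → ℂ) (i : Fin u) (a : Fin (s i)) :
    (shiftMatrix s k *ᵥ x) ⟨i, a⟩ = ext s x i (a + k i) := by
  rw [shiftMatrix, blockDiagonal'_mulVec]
  simp only [backwardShift_pow_apply]
  exact sum_ite_mul_eq x i _

lemma jordanMatrix_mulVec (s : Fin u → ℕ) (μ : Fin u → ℂ) (x : BlockIdx s → ℂ) (i : Fin u)
    (a : Fin (s i)) :
    (jordanMatrix s μ *ᵥ x) ⟨i, a⟩ = μ i * x ⟨i, a⟩ + ext s x i (a + 1) := by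
  rw [jordanMatrix, blockDiagonal'_mulVec]
  simp only [Matrix.add_apply, add_mul, Finset.sum_add_distrib]
  congr 1
  · simp [Matrix.one_apply]
  · simp only [backwardShift, Matrix.of_apply]
    exact sum_ite_mul_eq x i _

lemma ext_injective (s : Fin u → ℕ) : Function.Injective (ext s) := fun x y h => by
  funext p
  rw [← ext_apply_fin x, ← ext_apply_fin y, h]

lemma ext_mem_bounded (s : Fin u → ℕ) (x : BlockIdx s → ℂ) : ext s x ∈ bounded s :=
  fun i a h => by simp [ext_apply, Nat.not_lt.2 h]

lemma exists_ext_eq {s : Fin u → ℕ} {y : BlockSeq u} (hy : y ∈ bounded s) :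
    ∃ x, ext s x = y := by
  refine ⟨fun p => y p.1 p.2, ?_⟩
  funext i a
  rw [ext_apply]
  split_ifs with h
  · rfl
  · exact (hy i a (not_lt.1 h)).symm

lemma isCoord_ext (s : Fin u → ℕ) (μ : Fin u → ℂ) :
    IsCoord (Matrix.toLin' (jordanMatrix s μ)) s μ (ext s) where
  inj := ext_injective s
  range_eq := by
    ext y
    exact ⟨by rintro ⟨x, rfl⟩; exact ext_mem_bounded s x, exists_ext_eq⟩
  map x := by
    funext i a
    rw [toLin'_apply, jordan_apply]
    by_cases h : a < s i
    · rw [ext_apply_of_lt _ h, jordanMatrix_mulVec, ext_apply_of_lt x h]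
    · have h1 := ext_mem_bounded s x i a (by omega)
      have h2 := ext_mem_bounded s x i (a + 1) (by omega)
      simp [h1, h2, ext_apply, h]

/-- The shift by `k i` discards exactly the first `k i` entries of block `i`, so kernels of the
matrices Z are spanned by initial positions. -/
lemma mem_ker_shiftMatrix {s k : Fin u → ℕ} {x : BlockIdx s → ℂ} :
    shiftMatrix s k *ᵥ x = 0 ↔ ext s x ∈ bounded k := by
  rw [BlockSeq.mem_bounded]
  constructor
  · intro h i a ha
    by_cases has : a < s i
    · have := congrFun h ⟨i, a - k i, by omega⟩
      rwa [shiftMatrix_mulVec, Nat.sub_add_cancel ha] at this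
    · exact ext_mem_bounded s x i a (by omega)
  · intro h
    funext p
    obtain ⟨i, a⟩ := p
    rw [shiftMatrix_mulVec]
    exact h i _ (by omega)

lemma shiftMatrix_injOn {s k l : Fin u → ℕ} (hk : k ≤ s) (hl : l ≤ s)
    (h : shiftMatrix s k = shiftMatrix s l) : k = l := by
  have key : ∀ {k l : Fin u → ℕ}, k ≤ s → shiftMatrix s k = shiftMatrix s l → k ≤ l := by
    intro k l hk h i
    by_contra! hlt
    have h1 : l i < s i := hlt.trans_le (hk i)
    -- The basis vector at position `l i` tells the kernels apart: it is killed by the power `k` but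
    -- not by the power `l`.
    have h2 : shiftMatrix s k *ᵥ Pi.single ⟨i, l i, h1⟩ 1 = 0 := by
      rw [mem_ker_shiftMatrix, ext_single]
      intro j a ha
      rw [unit_apply, if_neg]
      rintro ⟨rfl, rfl⟩
      exact absurd ha (not_le.2 hlt)
    rw [h, mem_ker_shiftMatrix, ext_single] at h2
    have h3 := h2 i (l i) le_rfl
    simp [unit_apply] at h3
  exact le_antisymm (key hk h) (key hl h.symm)

lemma shiftMatrix_ker_le_iff {s k l : Fin u → ℕ} (hk : k ≤ s) :
    LinearMap.ker (shiftMatrix s k).mulVecLin ≤ LinearMap.ker (shiftMatrix s l).mulVecLin ↔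
      k ≤ l := by
  simp only [SetLike.le_def, LinearMap.mem_ker, mulVecLin_apply, mem_ker_shiftMatrix]
  constructor
  · intro h i
    by_contra! hlt
    have h1 : l i < s i := hlt.trans_le (hk i)
    have h2 : ext s (Pi.single ⟨i, l i, h1⟩ 1) ∈ bounded k := by
      rw [ext_single]
      intro j a ha
      rw [unit_apply, if_neg]
      rintro ⟨rfl, rfl⟩
      exact absurd ha (not_le.2 hlt)
    have h3 := h h2 i (l i) le_rfl
    simp [ext_single, unit_apply] at h3
  · exact fun h x hx => bounded_mono h hx

end BlockSeq

/-! ### Matrices commuting with a Jordan matrix, and represented subspaces. -/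

namespace BlockSeq

variable {u : ℕ} {s k : Fin u → ℕ} {μ : Fin u → ℂ}

/-- The matrix preserves eigenvalues and does not raise positions. -/
def IsLower (μ : Fin u → ℂ) (B : Matrix (BlockIdx s) (BlockIdx s) ℂ) : Prop :=
  ∀ p q, B p q ≠ 0 → μ p.1 = μ q.1 ∧ pos p.1 p.2 ≤ pos q.1 q.2

lemma pos_idx_inj {p q : BlockIdx s} : pos p.1 p.2 = pos q.1 q.2 ↔ p = q := by
  rw [pos_inj]
  constructor
  · rintro ⟨h1, h2⟩
    obtain ⟨i, a⟩ := p
    obtain ⟨j, b⟩ := q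
    obtain rfl : i = j := h1
    obtain rfl : a = b := Fin.ext h2
    rfl
  · rintro rfl
    exact ⟨rfl, rfl⟩

/-- A triangular matrix raises no position, and at the lead only the diagonal entry contributes. -/
lemma IsLower.hasLead {B : Matrix (BlockIdx s) (BlockIdx s) ℂ} (hB : IsLower μ B)
    (hd : ∀ p, B p p ≠ 0) {x : BlockIdx s → ℂ} {j : Fin u} {a : ℕ} (h : HasLead μ j a (ext s x)) :
    HasLead μ j a (ext s (B *ᵥ x)) := by
  have hx : ∀ q : BlockIdx s, x q ≠ 0 → μ q.1 = μ j ∧ pos q.1 q.2 ≤ pos j a := fun q hq => by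
    rw [← ext_apply_fin x q] at hq
    exact ⟨h.eig _ _ hq, h.le _ _ hq⟩
  have ha : a < s j := lt_of_mem_bounded (ext_mem_bounded s x) h.ne
  have main : ∀ i b, ext s (B *ᵥ x) i b ≠ 0 → μ i = μ j ∧ pos i b ≤ pos j a := by
    intro i b hb
    have hbs : b < s i := lt_of_mem_bounded (ext_mem_bounded s _) hb
    rw [ext_apply_of_lt _ hbs] at hb
    obtain ⟨q, -, hq⟩ := Finset.exists_ne_zero_of_sum_ne_zero hb
    have h1 := hB _ _ (left_ne_zero_of_mul hq)
    have h2 := hx q (right_ne_zero_of_mul hq)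
    exact ⟨h1.1.trans h2.1, h1.2.trans h2.2⟩
  refine ⟨?_, fun i b hb => (main i b hb).1, fun i b hb => (main i b hb).2⟩
  rw [ext_apply_of_lt _ ha]
  have : (B *ᵥ x) ⟨j, a, ha⟩ = B ⟨j, a, ha⟩ ⟨j, a, ha⟩ * x ⟨j, a, ha⟩ := by
    refine Finset.sum_eq_single _ (fun q _ hq => ?_) (by simp)
    by_contra hne
    have h1 := (hB _ _ (left_ne_zero_of_mul hne)).2
    have h2 := (hx q (right_ne_zero_of_mul hne)).2
    exact hq (pos_idx_inj.1 (le_antisymm h2 h1))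
  rw [this]
  refine mul_ne_zero (hd _) ?_
  rw [← ext_apply_of_lt x ha]
  exact h.ne

/-- The entries of a matrix that commutes with a Jordan matrix. -/
lemma commute_entry {B : Matrix (BlockIdx s) (BlockIdx s) ℂ} (hB : Commute B (jordanMatrix s μ))
    {p q : BlockIdx s} (h : B p q ≠ 0) :
    μ p.1 = μ q.1 ∧ (p.2 : ℕ) ≤ q.2 ∧ (p.2 : ℕ) + s q.1 ≤ q.2 + s p.1 := by
  obtain ⟨i, b⟩ := p
  obtain ⟨j, a⟩ := q
  have hc := isCoord_ext s μ
  have hcol : ∀ q : BlockIdx s, Matrix.toLin' B (Pi.single q 1) = fun p => B p q := fun q => by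
    rw [toLin'_apply, mulVec_single_one]; rfl
  have hcomm : ∀ r x, Matrix.toLin' B
      (((toLin' (jordanMatrix s μ) - μ j • 1 : Module.End ℂ (BlockIdx s → ℂ)) ^ r) x) =
      ((toLin' (jordanMatrix s μ) - μ j • 1 : Module.End ℂ (BlockIdx s → ℂ)) ^ r)
        (Matrix.toLin' B x) := by
    intro r x
    have h1 : Commute (Matrix.toLin' B) (toLin' (jordanMatrix s μ)) := by
      have := congrArg Matrix.toLin' hB.eq
      rw [toLin'_mul, toLin'_mul] at this
      exact this
    have h2 : Commute (Matrix.toLin' B) ((toLin' (jordanMatrix s μ) - μ j • 1) ^ r) :=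
      (h1.sub_right ((Commute.one_right _).smul_right _)).pow_right r
    exact LinearMap.congr_fun h2.eq x
  have hne : ext s (toLin' B (Pi.single ⟨j, a⟩ 1)) i b ≠ 0 := by
    rw [hcol, ext_apply_of_lt _ b.2]
    exact h
  -- The basis vector at position `a` is killed by the power `a + 1` of the nilpotent part, hence so
  -- is its image; this bounds the position in the image by `a`.
  have h1 : ((toLin' (jordanMatrix s μ) - μ j • 1) ^ ((a : ℕ) + 1))
      (toLin' B (Pi.single ⟨j, a⟩ 1)) = 0 := by
    rw [← hcomm, hc.pow_eq_zero_iff.2, map_zero]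
    intro i' c hc'
    rw [ext_single, unit_apply] at hc'
    have : i' = j ∧ c = a := by by_contra hh; simp [hh] at hc'
    rw [this.1, this.2]
    exact ⟨rfl, Nat.lt_succ_self _⟩
  obtain ⟨hij, hba⟩ := hc.pow_eq_zero_iff.1 h1 i b hne
  refine ⟨hij, Nat.lt_succ_iff.1 hba, ?_⟩
  have htop : s j - 1 < s j := by have := a.2; omega
  -- The same basis vector comes from the last one of its block by the power `s j - 1 - a`. Its
  -- image is therefore a shift by that amount too, which gives the second inequality.
  have h2 : ((toLin' (jordanMatrix s μ) - μ j • 1) ^ (s j - 1 - a))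
      (Pi.single (⟨j, ⟨s j - 1, htop⟩⟩ : BlockIdx s) (1 : ℂ)) = Pi.single ⟨j, a⟩ 1 := by
    rw [← sub_eq_zero]
    apply ext_injective s
    rw [map_sub, map_zero, sub_eq_zero]
    funext i' c
    by_cases hi' : μ i' = μ j
    · rw [hc.pow_apply hi', ext_single, ext_single, unit_apply, unit_apply]
      congr 1
      have := a.2
      simp only [eq_iff_iff, and_congr_right_iff]
      intro _
      omega
    · rw [ext_single, unit_apply, if_neg (by rintro ⟨rfl, -⟩; exact hi' rfl)]
      by_contra hne'
      refine hi' (hc.pow_eq_zero_iff (p := (a : ℕ) + 1).1 ?_ i' c hne').1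
      rw [← Module.End.mul_apply, ← pow_add]
      refine hc.pow_eq_zero_iff.2 fun i'' c' hc' => ?_
      rw [ext_single, unit_apply] at hc'
      have : i'' = j ∧ c' = s j - 1 := by by_contra hh; simp [hh] at hc'
      have := a.2
      rw [‹i'' = j ∧ c' = s j - 1›.1, ‹i'' = j ∧ c' = s j - 1›.2]
      exact ⟨rfl, by omega⟩
  rw [← h2, hcomm, hc.pow_apply hij] at hne
  have h3 := lt_of_mem_bounded (ext_mem_bounded s _) hne
  have := a.2
  dsimp only at h3 ⊢
  omega

lemma jordanMatrix_mulVec_single (s : Fin u → ℕ) (μ : Fin u → ℂ) {j : Fin u} {a : ℕ}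
    (ha : a < s j) :
    jordanMatrix s μ *ᵥ Pi.single (⟨j, a, ha⟩ : BlockIdx s) (1 : ℂ) =
      μ j • Pi.single ⟨j, a, ha⟩ 1 +
        if h : 0 < a then Pi.single ⟨j, a - 1, by omega⟩ 1 else 0 := by
  apply ext_injective s
  rw [← toLin'_apply, (isCoord_ext s μ).map]
  funext i' c
  split_ifs with h
  · simp only [map_add, map_smul, ext_single, jordan_apply, Pi.add_apply, Pi.smul_apply,
      smul_eq_mul, unit_apply]
    by_cases h1 : i' = j
    · subst h1
      have h2 : c + 1 = a ↔ c = a - 1 := by omega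
      simp [h2]
    · simp [h1]
  · simp only [map_add, map_smul, ext_single, jordan_apply, Pi.add_apply, Pi.smul_apply,
      smul_eq_mul, unit_apply, map_zero, Pi.zero_apply]
    by_cases h1 : i' = j
    · subst h1
      have h2 : c + 1 ≠ a := by omega
      simp [h2]
    · simp [h1]

/-- The entries of a matrix that commutes with a Jordan matrix are constant along diagonals. -/
lemma commute_entry_succ {B : Matrix (BlockIdx s) (BlockIdx s) ℂ}
    (hB : Commute B (jordanMatrix s μ)) {i j : Fin u} (hij : μ i = μ j) {a b : ℕ}
    (ha : a + 1 < s j) (hb : b + 1 < s i) :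
    B ⟨i, b + 1, hb⟩ ⟨j, a + 1, ha⟩ =
      B ⟨i, b, Nat.lt_of_succ_lt hb⟩ ⟨j, a, Nat.lt_of_succ_lt ha⟩ := by
  have h := congrFun (congrArg (· *ᵥ Pi.single (⟨j, a + 1, ha⟩ : BlockIdx s) (1 : ℂ)) hB.eq)
    ⟨i, b, Nat.lt_of_succ_lt hb⟩
  simp only [← mulVec_mulVec] at h
  rw [jordanMatrix_mulVec_single, dif_pos (Nat.succ_pos a), mulVec_add, mulVec_smul,
    mulVec_single_one, mulVec_single_one, jordanMatrix_mulVec,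
    ext_apply_of_lt _ hb] at h
  simp only [Pi.add_apply, Pi.smul_apply, smul_eq_mul, hij] at h
  simpa [Matrix.col] using h.symm

lemma commute_entry_diag {B : Matrix (BlockIdx s) (BlockIdx s) ℂ}
    (hB : Commute B (jordanMatrix s μ)) {i j : Fin u} (hij : μ i = μ j) {a : ℕ}
    (ha : a < s j) (hb : a < s i) :
    B ⟨i, a, hb⟩ ⟨j, a, ha⟩ = B ⟨i, 0, by omega⟩ ⟨j, 0, by omega⟩ := by
  induction a with
  | zero => rfl
  | succ a ih => rw [commute_entry_succ hB hij ha hb, ih]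

/-- By `commute_entry` positions never increase, so only entries between equal positions of
different blocks could violate the order. These are constant along the blocks and agree with the
entries between eigenvectors, where triangularity is assumed. -/
lemma isLower_of_commute {B : Matrix (BlockIdx s) (BlockIdx s) ℂ}
    (hB : Commute B (jordanMatrix s μ))
    (htri : ∀ (i j : Fin u) (hi : 0 < s i) (hj : 0 < s j), j < i → B ⟨i, 0, hi⟩ ⟨j, 0, hj⟩ = 0) :
    IsLower μ B := by
  rintro ⟨i, b, hb⟩ ⟨j, a, ha⟩ h
  obtain ⟨h1, h2, -⟩ := commute_entry hB h
  refine ⟨h1, ?_⟩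
  rw [pos_le_iff]
  dsimp only at h1 h2 ⊢
  by_contra! hlt
  obtain rfl : b = a := by omega
  rw [commute_entry_diag hB h1, htri i j _ _ (hlt.2 rfl)] at h
  exact h rfl

lemma IsLower.inv {B : Matrix (BlockIdx s) (BlockIdx s) ℂ} (hB : IsLower μ B) (hu : IsUnit B)
    (hc : Commute B (jordanMatrix s μ)) : IsLower μ B⁻¹ := by
  have hdet : IsUnit B.det := (Matrix.isUnit_iff_isUnit_det B).1 hu
  let _ := Matrix.invertibleOfIsUnitDet B hdet
  have h1 : Matrix.BlockTriangular B (fun p : BlockIdx s => pos p.1 p.2) := fun p q hpq => by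
    by_contra hne
    exact absurd (hB p q hne).2 (not_le.2 hpq)
  have h2 := Matrix.blockTriangular_inv_of_blockTriangular h1
  have h3 : Commute B⁻¹ (jordanMatrix s μ) := by
    rw [← Matrix.invOf_eq_nonsing_inv]
    exact hc.invOf_left
  intro p q hne
  refine ⟨(commute_entry h3 hne).1, ?_⟩
  by_contra! hlt
  exact hne (h2 hlt)

lemma IsLower.diag_ne_zero {B C : Matrix (BlockIdx s) (BlockIdx s) ℂ} (hB : IsLower μ B)
    (hC : IsLower μ C) (hBC : B * C = 1) (p : BlockIdx s) : B p p ≠ 0 ∧ C p p ≠ 0 := by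
  have h := congrFun (congrFun hBC p) p
  rw [Matrix.mul_apply, Matrix.one_apply_eq, Finset.sum_eq_single p] at h
  · exact ⟨left_ne_zero_of_mul (h ▸ one_ne_zero), right_ne_zero_of_mul (h ▸ one_ne_zero)⟩
  · intro q _ hq
    by_contra hne
    exact hq (pos_idx_inj.1 (le_antisymm (hC _ _ (right_ne_zero_of_mul hne)).2
      (hB _ _ (left_ne_zero_of_mul hne)).2))
  · simp

/-- At the highest position of the support of `x`, the product `B *ᵥ x` has the diagonal entry times
a nonzero number, so the kernel is zero. -/
lemma IsLower.isUnit {B : Matrix (BlockIdx s) (BlockIdx s) ℂ} (hB : IsLower μ B)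
    (hd : ∀ p, B p p ≠ 0) : IsUnit B := by
  classical
  rw [← Matrix.mulVec_injective_iff_isUnit]
  have h0 : ∀ x : BlockIdx s → ℂ, B *ᵥ x = 0 → x = 0 := by
    intro x hx
    by_contra hne
    let S : Finset (BlockIdx s) := Finset.univ.filter fun p => x p ≠ 0
    have hS : S.Nonempty := by
      obtain ⟨p, hp⟩ := Function.ne_iff.1 hne
      exact ⟨p, by simpa [S] using hp⟩
    obtain ⟨p, hp, hmax⟩ := S.exists_max_image (fun p => pos p.1 p.2) hS
    have hp' : x p ≠ 0 := by simpa [S] using hp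
    have h := congrFun hx p
    have h1 : (B *ᵥ x) p = B p p * x p := by
      refine Finset.sum_eq_single p (fun q _ hq => ?_) (by simp)
      by_contra hne
      have h2 := (hB _ _ (left_ne_zero_of_mul hne)).2
      have h3 := hmax q (by simpa [S] using right_ne_zero_of_mul hne)
      exact hq (pos_idx_inj.1 (le_antisymm h3 h2))
    rw [h1, Pi.zero_apply] at h
    exact mul_ne_zero (hd p) hp' h
  intro x y hxy
  rw [← sub_eq_zero]
  apply h0
  rw [mulVec_sub, sub_eq_zero]
  exact hxy

/-- `N` is obtained from the powers `k` and the change of variables `T` over block sizes `s`. -/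
def Represents (s : Fin u → ℕ) (μ : Fin u → ℂ) (k : Fin u → ℕ)
    (T : Matrix (BlockIdx s) (BlockIdx s) ℂ) (N : Submodule ℂ (BlockSeq u)) : Prop :=
  IsUnit T ∧ Commute T (jordanMatrix s μ) ∧
    (∀ (i j : Fin u) (hi : 0 < s i) (hj : 0 < s j), j < i → T ⟨i, 0, hi⟩ ⟨j, 0, hj⟩ = 0) ∧
    N = (LinearMap.ker (shiftMatrix s k * T⁻¹).mulVecLin).map (ext s)

lemma mem_ker_mul_inv {T : Matrix (BlockIdx s) (BlockIdx s) ℂ} {x : BlockIdx s → ℂ} :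
    x ∈ LinearMap.ker (shiftMatrix s k * T⁻¹).mulVecLin ↔ ext s (T⁻¹ *ᵥ x) ∈ bounded k := by
  rw [LinearMap.mem_ker, mulVecLin_apply, ← mulVec_mulVec, mem_ker_shiftMatrix]

variable {T : Matrix (BlockIdx s) (BlockIdx s) ℂ} {N : Submodule ℂ (BlockSeq u)}

namespace Represents

lemma inv_mul (h : Represents s μ k T N) : T⁻¹ * T = 1 :=
  Matrix.nonsing_inv_mul T ((Matrix.isUnit_iff_isUnit_det T).1 h.1)

lemma mul_inv (h : Represents s μ k T N) : T * T⁻¹ = 1 :=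
  Matrix.mul_nonsing_inv T ((Matrix.isUnit_iff_isUnit_det T).1 h.1)

lemma commute_inv (h : Represents s μ k T N) : Commute T⁻¹ (jordanMatrix s μ) := by
  have h1 : T⁻¹ * (T * jordanMatrix s μ) * T⁻¹ = T⁻¹ * (jordanMatrix s μ * T) * T⁻¹ := by
    rw [h.2.1.eq]
  rw [← Matrix.mul_assoc, h.inv_mul, Matrix.one_mul, Matrix.mul_assoc, Matrix.mul_assoc,
    h.mul_inv, Matrix.mul_one] at h1
  exact h1.symm

/-- The kernel of Z T⁻¹ is the image under T of the kernel of Z; together with `exists_eq` this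
replaces the inverse matrix by a parametrization of `N`. -/
lemma mulVec_mem_iff (h : Represents s μ k T N) (x : BlockIdx s → ℂ) :
    ext s (T *ᵥ x) ∈ N ↔ ext s x ∈ bounded k := by
  have h1 : T *ᵥ x ∈ LinearMap.ker (shiftMatrix s k * T⁻¹).mulVecLin ↔ ext s x ∈ bounded k := by
    rw [mem_ker_mul_inv, mulVec_mulVec, h.inv_mul, one_mulVec]
  rw [h.2.2.2, ← h1]
  exact (ext_injective s).mem_set_image

lemma exists_eq (h : Represents s μ k T N) {y : BlockSeq u} (hy : y ∈ N) :
    ∃ x, ext s x ∈ bounded k ∧ ext s (T *ᵥ x) = y := by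
  have hy' := hy
  rw [h.2.2.2] at hy'
  obtain ⟨x, hx, rfl⟩ := hy'
  refine ⟨T⁻¹ *ᵥ x, mem_ker_mul_inv.1 hx, ?_⟩
  rw [mulVec_mulVec, h.mul_inv, one_mulVec]

lemma isLower (h : Represents s μ k T N) : IsLower μ T := isLower_of_commute h.2.1 h.2.2.1

lemma isLower_inv (h : Represents s μ k T N) : IsLower μ T⁻¹ := h.isLower.inv h.1 h.2.1

lemma le_bounded (h : Represents s μ k T N) : N ≤ bounded s := fun y hy => by
  obtain ⟨x, -, rfl⟩ := h.exists_eq hy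
  exact ext_mem_bounded s _

lemma jordan_mem (h : Represents s μ k T N) (y : BlockSeq u) (hy : y ∈ N) : jordan μ y ∈ N := by
  obtain ⟨x, hx, rfl⟩ := h.exists_eq hy
  rw [← (isCoord_ext s μ).map, toLin'_apply, mulVec_mulVec, ← h.2.1.eq, ← mulVec_mulVec,
    h.mulVec_mem_iff, ← toLin'_apply, (isCoord_ext s μ).map]
  exact jordan_mem_bounded μ hx

/-- Both `T` and `T⁻¹` preserve leads, so `N` has the same leads as the kernel of Z. The bound `k ≤
s` is needed because powers beyond the block size all give the same kernel. -/
lemma hasProfile (h : Represents s μ k T N) (hk : k ≤ s) : HasProfile μ N k := by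
  have hd := h.isLower.diag_ne_zero h.isLower_inv h.mul_inv
  intro j a
  constructor
  · rintro ⟨y, hy, hl⟩
    obtain ⟨x, hx, rfl⟩ := h.exists_eq hy
    have h1 := h.isLower_inv.hasLead (fun p => (hd p).2) hl
    rw [mulVec_mulVec, h.inv_mul, one_mulVec] at h1
    exact lt_of_mem_bounded hx h1.ne
  · intro ha
    have has := ha.trans_le (hk j)
    have h0 : HasLead μ j a (ext s (Pi.single ⟨j, a, has⟩ 1)) := by
      rw [ext_single]
      exact hasLead_unit μ j a
    refine ⟨_, (h.mulVec_mem_iff _).2 ?_, h.isLower.hasLead (fun p => (hd p).1) h0⟩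
    rw [ext_single]
    intro i b hb
    rw [unit_apply, if_neg]
    rintro ⟨rfl, rfl⟩
    exact absurd hb (not_le.2 ha)

end Represents

/-! ### Building T from one chain per block. -/

/-- The matrix whose column at position `a` of block `j` is obtained from the vector `v j` with
leading position `κ j - 1` by moving it up so that its leading position becomes `a`. -/
def chainMatrix (s κ : Fin u → ℕ) (v : Fin u → BlockSeq u) :
    Matrix (BlockIdx s) (BlockIdx s) ℂ :=
  Matrix.of fun p q =>
    -- The guard keeps the subtraction exact; truncation would otherwise repeat the entry at
    -- position `0`.
    if (q.2 : ℕ) + 1 ≤ p.2 + κ q.1 then v q.1 p.1 (p.2 + κ q.1 - 1 - q.2) else 0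

section ChainMatrix

variable {κ : Fin u → ℕ} {v : Fin u → BlockSeq u}

/-- Depth says that even the highest upward shift, to position `s j - 1`, stays within the sizes
`s`. Thus cutting the column off at these sizes loses nothing. -/
lemma ext_chainMatrix_single (hdeep : ∀ j i a, v j i a ≠ 0 → a + s j < s i + κ j)
    {j : Fin u} {a : ℕ} (ha : a < s j) (i : Fin u) (b : ℕ) :
    ext s (chainMatrix s κ v *ᵥ Pi.single ⟨j, a, ha⟩ 1) i b =
      if a + 1 ≤ b + κ j then v j i (b + κ j - 1 - a) else 0 := by
  rw [mulVec_single_one]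
  by_cases hb : b < s i
  · rw [ext_apply_of_lt _ hb]
    rfl
  · rw [ext_mem_bounded s _ i b (not_lt.1 hb)]
    split_ifs with h
    · by_contra hne
      have := hdeep j i _ (Ne.symm hne)
      omega
    · rfl

lemma commute_chainMatrix (hκ : ∀ j, 0 < κ j) (hlead : ∀ j, HasLead μ j (κ j - 1) (v j))
    (hdeep : ∀ j i a, v j i a ≠ 0 → a + s j < s i + κ j) :
    Commute (chainMatrix s κ v) (jordanMatrix s μ) := by
  have hvan : ∀ j i, v j i (κ j) = 0 := fun j i => by
    by_contra hne
    have := pos_le_iff.1 ((hlead j).le _ _ hne)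
    have := hκ j
    omega
  have heig : ∀ i j c, μ i * v j i c = μ j * v j i c := fun i j c => by
    by_cases h0 : v j i c = 0
    · simp [h0]
    · rw [(hlead j).eig _ _ h0]
  apply Matrix.ext_of_mulVec_single
  rintro ⟨j, a, ha⟩
  rw [← mulVec_mulVec, ← mulVec_mulVec]
  apply ext_injective s
  rw [← toLin'_apply (jordanMatrix s μ) (chainMatrix s κ v *ᵥ _), (isCoord_ext s μ).map]
  rw [jordanMatrix_mulVec_single, mulVec_add, mulVec_smul, map_add, map_smul]
  funext i b
  rw [jordan_apply, ext_chainMatrix_single hdeep, ext_chainMatrix_single hdeep, Pi.add_apply,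
    Pi.add_apply, Pi.smul_apply, Pi.smul_apply, ext_chainMatrix_single hdeep, smul_eq_mul]
  congr 1
  · split_ifs
    · exact (heig _ _ _).symm
    · simp
  · by_cases h : 0 < a
    · rw [dif_pos h, ext_chainMatrix_single hdeep]
      have h1 : a - 1 + 1 ≤ b + κ j ↔ a + 1 ≤ b + 1 + κ j := by omega
      simp only [h1]
      rw [show b + κ j - 1 - (a - 1) = b + 1 + κ j - 1 - a by omega]
    · rw [dif_neg h, mulVec_zero, map_zero]
      -- Column `0` must be an eigenvector: one more shift reads `v j` only from position `κ j` on,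
      -- beyond its lead.
      obtain rfl : a = 0 := by omega
      split_ifs with h1
      · rw [show b + 1 + κ j - 1 - 0 = b + κ j by omega]
        by_contra hne
        have h2 := pos_le_iff.1 ((hlead j).le i (b + κ j) (Ne.symm hne))
        have h3 := hκ j
        omega
      · rfl

/-- The columns at positions below `k j` are downward shifts of `v j` and so lie in `N`. Their span
has the profile `k` of `N` and therefore equals `N`. Blocks with `k j = 0` only have to supply
further columns that keep T invertible and commuting. -/
lemma chainMatrix_represents (hN : ∀ y ∈ N, jordan μ y ∈ N)
    (hcomp : ∀ z, ∀ y ∈ N, component μ z y ∈ N) (hs : N ≤ bounded s)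
    (hprof : HasProfile μ N k) (hκ : ∀ j, 0 < κ j)
    (hlead : ∀ j, HasLead μ j (κ j - 1) (v j))
    (hdeep : ∀ j i a, v j i a ≠ 0 → a + s j < s i + κ j)
    (hv : ∀ j, 0 < k j → κ j = k j ∧ v j ∈ N) :
    Represents s μ k (chainMatrix s κ v) N := by
  have hcomm := commute_chainMatrix hκ hlead hdeep
  have htri : ∀ (i j : Fin u) (hi : 0 < s i) (hj : 0 < s j), j < i →
      chainMatrix s κ v ⟨i, 0, hi⟩ ⟨j, 0, hj⟩ = 0 := by
    intro i j hi hj hij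
    simp only [chainMatrix, of_apply]
    split_ifs
    · by_contra hne
      have h1 := pos_le_iff.1 ((hlead j).le i (0 + κ j - 1 - 0) hne)
      omega
    · rfl
  have hlow := isLower_of_commute hcomm htri
  have hdiag : ∀ p, chainMatrix s κ v p p ≠ 0 := by
    rintro ⟨j, a, ha⟩
    have := hκ j
    simp only [chainMatrix, of_apply]
    rw [if_pos (by omega), show a + κ j - 1 - a = κ j - 1 by omega]
    exact (hlead j).ne
  have hunit := hlow.isUnit hdiag
  have hrep : Represents s μ k (chainMatrix s κ v) _ := ⟨hunit, hcomm, htri, rfl⟩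
  have hle : (LinearMap.ker (shiftMatrix s k * (chainMatrix s κ v)⁻¹).mulVecLin).map (ext s) ≤
      N := by
    intro y hy
    obtain ⟨x, hx, rfl⟩ := hrep.exists_eq hy
    have hsum : x = ∑ p, x p • Pi.single p (1 : ℂ) := by
      conv_lhs => rw [← Finset.univ_sum_single x]
      exact Finset.sum_congr rfl fun p _ => by rw [← Pi.single_smul, smul_eq_mul, mul_one]
    rw [hsum, mulVec_sum, map_sum]
    refine N.sum_mem fun p _ => ?_
    obtain ⟨j, a, ha⟩ := p
    rw [mulVec_smul, map_smul]
    by_cases h0 : x ⟨j, a, ha⟩ = 0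
    · rw [h0, zero_smul]
      exact N.zero_mem
    · rw [← ext_apply_of_lt x ha] at h0
      have hak := lt_of_mem_bounded hx h0
      obtain ⟨h1, h2⟩ := hv j (by omega)
      refine N.smul_mem _ ?_
      convert shift_mem hN h2 (hlead j).supportedAt (κ j - 1 - a) using 1
      funext i b
      rw [ext_chainMatrix_single hdeep, if_pos (by omega),
        show b + κ j - 1 - a = b + (κ j - 1 - a) by omega]
  exact ⟨hunit, hcomm, htri, le_antisymm (le_of_hasLead hle hs hcomp (fun j a => (hprof j a).1)
    (fun j a => (hrep.hasProfile (hprof.le hs) j a).2)) hle⟩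

end ChainMatrix

end BlockSeq

/-! ### Transfer to A through a Jordan form. -/

namespace JordanForm

variable {n : ℕ} {A : Matrix (Fin n) (Fin n) ℂ}

open BlockSeq

/-- The Jordan coordinates of a vector. -/
def coord (F : JordanForm A) : (Fin n → ℂ) →ₗ[ℂ] BlockSeq F.u :=
  ext F.size ∘ₗ F.Qinv.mulVecLin

lemma coord_apply (F : JordanForm A) (v : Fin n → ℂ) : F.coord v = ext F.size (F.Qinv *ᵥ v) := rfl

lemma coord_Q_mulVec (F : JordanForm A) (x : BlockIdx F.size → ℂ) :
    F.coord (F.Q *ᵥ x) = ext F.size x := by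
  rw [coord_apply, mulVec_mulVec, F.Qinv_mul_Q, one_mulVec]

lemma Q_mulVec_Qinv_mulVec (F : JordanForm A) (v : Fin n → ℂ) : F.Q *ᵥ (F.Qinv *ᵥ v) = v := by
  rw [mulVec_mulVec, F.Q_mul_Qinv, one_mulVec]

lemma isCoord (F : JordanForm A) : IsCoord (Matrix.toLin' A) F.size F.eig F.coord where
  inj v w h := by
    have h1 := ext_injective F.size h
    rw [← F.Q_mulVec_Qinv_mulVec v, ← F.Q_mulVec_Qinv_mulVec w]
    exact congrArg _ h1
  range_eq := by
    ext y
    constructor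
    · rintro ⟨v, rfl⟩
      exact ext_mem_bounded _ _
    · intro hy
      obtain ⟨x, rfl⟩ := exists_ext_eq hy
      exact ⟨F.Q *ᵥ x, F.coord_Q_mulVec x⟩
  map v := by
    rw [toLin'_apply, coord_apply, coord_apply, ← (isCoord_ext F.size F.eig).map, toLin'_apply,
      mulVec_mulVec, mulVec_mulVec]
    have h : F.Qinv * (F.Q * jordanMatrix F.size F.eig * F.Qinv) =
        jordanMatrix F.size F.eig * F.Qinv := by
      rw [← Matrix.mul_assoc, ← Matrix.mul_assoc, F.Qinv_mul_Q, Matrix.one_mul]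
    rw [← F.eq_conj] at h
    rw [h]

lemma map_ext_pull (F : JordanForm A) (N : Submodule ℂ (Fin n → ℂ)) :
    (F.pull N).map (ext F.size) = N.map F.coord :=
  (Submodule.map_comp _ _ _).symm

/-- The rightmost block of the last vector of a chain of length k is the block of the lead of its
first vector, and the lead is at position `k - 1`. -/
lemma chainLength_eq (F : JordanForm A) (N : Submodule ℂ (Fin n → ℂ)) :
    F.chainLength N = fun j =>
      sSup {k | 0 < k ∧ ∃ y ∈ N.map F.coord, HasLead F.eig j (k - 1) y} := by
  funext j
  unfold chainLength
  congr 1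
  ext k
  simp only [Set.mem_ofPred_eq]
  refine and_congr_right fun hk => ?_
  rw [← map_ext_pull, ← (isCoord_ext F.size F.eig).exists_chain_iff hk]
  refine exists_congr fun v => and_congr_right fun _ => ?_
  have h1 : (Matrix.toLin' (jordanMatrix F.size F.eig) - F.eig j • 1 : Module.End ℂ _) =
      Matrix.toLin' (jordanMatrix F.size F.eig - F.eig j • 1) := by
    rw [map_sub, map_smul, toLin'_one]
    rfl
  rw [h1, ← toLin'_pow, toLin'_apply, toLin'_apply]
  simp only [exists_eq_left]
  refine and_congr Iff.rfl (and_congr ?_ ?_)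
  · constructor
    · rintro ⟨a, ha⟩
      exact ⟨a, by rwa [ext_apply_of_lt _ a.2]⟩
    · rintro ⟨a, ha⟩
      have h2 := lt_of_mem_bounded (ext_mem_bounded _ _) ha
      exact ⟨⟨a, h2⟩, by rwa [ext_apply_of_lt _ h2] at ha⟩
  · refine forall_congr' fun i => forall_congr' fun _ => ?_
    constructor
    · intro h a
      rw [ext_apply]
      split_ifs
      · exact h _
      · rfl
    · intro h a
      rw [← h a, ext_apply_of_lt _ a.2]

lemma hasProfile (F : JordanForm A) {N : Submodule ℂ (Fin n → ℂ)} (hN : N ∈ invariantLattice A) :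
    HasProfile F.eig (N.map F.coord) (F.chainLength N) := by
  rw [chainLength_eq]
  exact hasProfile_sSup (F.isCoord.jordan_mem hN) (F.isCoord.map_le N)

lemma chainLength_le (F : JordanForm A) {N : Submodule ℂ (Fin n → ℂ)}
    (hN : N ∈ invariantLattice A) : F.chainLength N ≤ F.size :=
  (F.hasProfile hN).le (F.isCoord.map_le N)

lemma size_le_expandedSize (F : JordanForm A) (E : Set ℂ) : F.size ≤ F.expandedSize E := by
  intro i
  unfold expandedSize
  split_ifs
  · exact le_max_left _ _
  · exact le_rfl

lemma expandedSize_of_notMem (F : JordanForm A) {E : Set ℂ} {i : Fin F.u} (h : F.eig i ∉ E) :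
    F.expandedSize E i = F.size i := by
  simp [expandedSize, h]

lemma expandedSize_of_mem (F : JordanForm A) {E : Set ℂ} {i : Fin F.u} (h : F.eig i ∈ E) :
    F.expandedSize E i = max (F.size i) (F.maxSize (F.eig i) - 1) := by
  simp [expandedSize, h]

lemma expandedSize_empty (F : JordanForm A) : F.expandedSize ∅ = F.size :=
  funext fun _ => F.expandedSize_of_notMem (Set.notMem_empty _)

lemma size_le_maxSize (F : JordanForm A) {z : ℂ} {i : Fin F.u} (h : F.eig i = z) :
    F.size i ≤ F.maxSize z :=
  Finset.le_sup (f := F.size) (by simpa using h)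

/-- In sequence coordinates the inclusion into the expanded space is the identity, so `rowSelection`
disappears. -/
lemma represents_iff (F : JordanForm A) (E : Set ℂ) (k : Fin F.u → ℕ)
    (T : Matrix (BlockIdx (F.expandedSize E)) (BlockIdx (F.expandedSize E)) ℂ)
    (N : Submodule ℂ (Fin n → ℂ)) :
    F.Represents E k T N ↔
      BlockSeq.Represents (F.expandedSize E) F.eig k T (N.map F.coord) := by
  unfold JordanForm.Represents BlockSeq.Represents
  refine and_congr_right fun _ => and_congr_right fun _ => and_congr_right fun _ => ?_
  have h : ext (F.expandedSize E) ∘ₗ (rowSelection F.size (F.expandedSize E))ᵀ.mulVecLin =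
      ext F.size := by
    apply LinearMap.ext
    intro x
    funext i a
    rw [LinearMap.comp_apply, mulVecLin_apply]
    by_cases ha : a < F.expandedSize E i
    · rw [ext_apply_of_lt _ ha]
      simp only [mulVec, dotProduct, transpose_apply, rowSelection, of_apply,
        Fintype.sum_sigma]
      rw [Finset.sum_eq_single i]
      · simp only [true_and]
        exact sum_ite_mul_eq x i a
      · intro j _ hj
        exact Finset.sum_eq_zero fun b _ => by simp [hj]
      · simp
    · rw [ext_mem_bounded _ _ i a (not_lt.1 ha),
        ext_mem_bounded _ x i a ((F.size_le_expandedSize E i).trans (not_lt.1 ha))]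
  rw [← (Submodule.map_injective_of_injective (ext_injective (F.expandedSize E))).eq_iff,
    ← Submodule.map_comp, h, map_ext_pull]

lemma exists_represents_iff (F : JordanForm A) (E : Set ℂ) (k : Fin F.u → ℕ)
    (N : Submodule ℂ (Fin n → ℂ)) :
    (∃ T, F.Represents E k T N) ↔
      ∃ T, BlockSeq.Represents (F.expandedSize E) F.eig k T (N.map F.coord) :=
  exists_congr fun T => F.represents_iff E k T N

lemma mem_invariantLattice_of_represents (F : JordanForm A) {E : Set ℂ} {k : Fin F.u → ℕ}
    {T : Matrix (BlockIdx (F.expandedSize E)) (BlockIdx (F.expandedSize E)) ℂ}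
    {N : Submodule ℂ (Fin n → ℂ)} (h : F.Represents E k T N) : N ∈ invariantLattice A :=
  F.isCoord.mem_invtSubmodule ((F.represents_iff E k T N).1 h).jordan_mem

lemma chainLength_eq_of_represents (F : JordanForm A) {E : Set ℂ} {k : Fin F.u → ℕ}
    {T : Matrix (BlockIdx (F.expandedSize E)) (BlockIdx (F.expandedSize E)) ℂ}
    {N : Submodule ℂ (Fin n → ℂ)} (hk : k ≤ F.size) (h : F.Represents E k T N) :
    F.chainLength N = k :=
  (F.hasProfile (F.mem_invariantLattice_of_represents h)).unique
    (((F.represents_iff E k T N).1 h).hasProfile (hk.trans (F.size_le_expandedSize E)))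

/-- The longest chains of `N` with eigenvalue `z` can be chosen to lie as deep in the whole space
as their blocks permit. -/
def HasDeepChains (F : JordanForm A) (N : Submodule ℂ (Fin n → ℂ)) (z : ℂ) : Prop :=
  ∀ j, F.eig j = z → 0 < F.chainLength N j → ∃ y ∈ N.map F.coord,
    HasLead F.eig j (F.chainLength N j - 1) y ∧
      ∀ i a, y i a ≠ 0 → a + F.size j < F.size i + F.chainLength N j

/-- When block sizes with the same eigenvalue differ by at most one, all chains are deep. -/
lemma _root_.BlockSeq.HasLead.deep {u : ℕ} {s : Fin u → ℕ} {μ : Fin u → ℂ} {j : Fin u} {k : ℕ}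
    {y : BlockSeq u} (hl : HasLead μ j (k - 1) y) (hk : 0 < k)
    (hs : ∀ i, μ i = μ j → s j ≤ s i + 1 ∧ (s i < s j → j < i)) (i : Fin u) (a : ℕ)
    (h : y i a ≠ 0) : a + s j < s i + k := by
  have h1 := hs i (hl.eig i a h)
  have h2 := pos_le_iff.1 (hl.le i a h)
  by_cases h3 : s i < s j
  -- A smaller block lies to the right of block `j`, so the order excludes position `k - 1` there;
  -- this gains the one step by which the block is shorter.
  · have h4 := h1.2 h3
    omega
  · omega

lemma lt_of_size_lt (F : JordanForm A) {i j : Fin F.u} (he : F.eig i = F.eig j)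
    (h : F.size i < F.size j) : j < i := by
  by_contra! h'
  exact absurd (F.size_anti i j h' he) (not_le.2 h)

/-- After expansion all blocks of the eigenvalue have the maximal size or one less, and expansion
creates no new order among them. -/
lemma expandedSize_deep (F : JordanForm A) {E : Set ℂ} {j : Fin F.u} (hj : F.eig j ∈ E)
    (i : Fin F.u) (hi : F.eig i = F.eig j) :
    F.expandedSize E j ≤ F.expandedSize E i + 1 ∧
      (F.expandedSize E i < F.expandedSize E j → j < i) := by
  have h1 := F.size_le_maxSize hi
  have h2 := F.size_le_maxSize (rfl : F.eig j = F.eig j)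
  rw [F.expandedSize_of_mem hj, F.expandedSize_of_mem (hi.symm ▸ hj), hi]
  refine ⟨by omega, fun h => F.lt_of_size_lt hi ?_⟩
  omega

lemma hasDeepChains_of_size (F : JordanForm A) {N : Submodule ℂ (Fin n → ℂ)}
    (hN : N ∈ invariantLattice A) {z : ℂ}
    (hs : ∀ i j, F.eig i = z → F.eig j = z → F.size j ≤ F.size i + 1) : F.HasDeepChains N z := by
  intro j hj hk
  obtain ⟨y, hy, hl⟩ := (F.hasProfile hN j (F.chainLength N j - 1)).2 (by omega)
  exact ⟨y, hy, hl, hl.deep hk fun i hi => ⟨hs i j (hi.trans hj) hj, F.lt_of_size_lt hi⟩⟩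

/-- Depth of the chosen vectors comes from expansion at the eigenvalues in `E`, and from the
hypothesis at the others. -/
lemma exists_represents (F : JordanForm A) {N : Submodule ℂ (Fin n → ℂ)}
    (hN : N ∈ invariantLattice A) {E : Set ℂ} (hE : ∀ z, z ∉ E → F.HasDeepChains N z) :
    ∃ T, F.Represents E (F.chainLength N) T N := by
  rw [exists_represents_iff]
  have key : ∀ j, ∃ (κ : ℕ) (v : BlockSeq F.u), 0 < κ ∧ HasLead F.eig j (κ - 1) v ∧
      (∀ i a, v i a ≠ 0 → a + F.expandedSize E j < F.expandedSize E i + κ) ∧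
      (0 < F.chainLength N j → κ = F.chainLength N j ∧ v ∈ N.map F.coord) := by
    intro j
    by_cases hk : 0 < F.chainLength N j
    · by_cases hj : F.eig j ∈ E
      · obtain ⟨y, hy, hl⟩ := (F.hasProfile hN j (F.chainLength N j - 1)).2 (by omega)
        exact ⟨_, y, hk, hl, hl.deep hk (F.expandedSize_deep hj), fun _ => ⟨rfl, hy⟩⟩
      · obtain ⟨y, hy, hl, hd⟩ := hE _ hj j rfl hk
        refine ⟨_, y, hk, hl, fun i a h => ?_, fun _ => ⟨rfl, hy⟩⟩
        rw [F.expandedSize_of_notMem hj, F.expandedSize_of_notMem ((hl.eig i a h).symm ▸ hj)]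
        exact hd i a h
    -- For a block without a chain in `N` the eigenvector of the block with `κ = 1` makes its
    -- columns those of the identity.
    · refine ⟨1, unit j 0, one_pos, hasLead_unit _ _ _, fun i a h => ?_, fun h => absurd h hk⟩
      have : i = j ∧ a = 0 := by by_contra h'; simp [unit_apply, h'] at h
      rw [this.1, this.2]
      omega
  choose κ v hκ hlead hdeep hv using key
  exact ⟨_, chainMatrix_represents (F.isCoord.jordan_mem hN) (F.isCoord.component_mem hN)
    ((F.isCoord.map_le N).trans (bounded_mono (F.size_le_expandedSize E))) (F.hasProfile hN)
    hκ hlead hdeep hv⟩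

end JordanForm

/-! ### Marked subspaces and deep chains. -/

namespace BlockSeq

variable {n : ℕ} {A : Matrix (Fin n) (Fin n) ℂ}

/-- The coordinates with respect to a Jordan basis. -/
lemma exists_isCoord_of_isJordanBasis {t : ℕ} {l : Fin t → ℕ} {b : BlockIdx l → Fin n → ℂ}
    (hb : IsJordanBasis A ⊤ l b) :
    ∃ (ν : Fin t → ℂ) (φ : (Fin n → ℂ) →ₗ[ℂ] BlockSeq t),
      IsCoord (Matrix.toLin' A) l ν φ ∧ ∀ p, φ (b p) = unit p.1 p.2 := by
  obtain ⟨hli, hspan, ν, hν⟩ := hb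
  let B := Module.Basis.mk hli hspan.ge
  have hB : ∀ p, (ext l ∘ₗ B.equivFun.toLinearMap) (b p) = unit p.1 p.2 := fun p => by
    have h1 : b p = B p := (Module.Basis.mk_apply hli hspan.ge p).symm
    rw [h1, LinearMap.comp_apply, LinearEquiv.coe_coe, ← ext_single]
    congr 1
    funext q
    rw [Module.Basis.equivFun_self, Pi.single_apply]
    simp only [eq_comm]
  refine ⟨ν, ext l ∘ₗ B.equivFun.toLinearMap, ⟨?_, ?_, ?_⟩, hB⟩
  · exact (ext_injective l).comp B.equivFun.injective
  · rw [LinearMap.range_comp, LinearEquiv.range, Submodule.map_top]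
    exact (isCoord_ext l ν).range_eq
  · intro v
    have : (ext l ∘ₗ B.equivFun.toLinearMap) ∘ₗ Matrix.toLin' A =
        jordan ν ∘ₗ (ext l ∘ₗ B.equivFun.toLinearMap) := by
      refine B.ext fun p => ?_
      rw [Module.Basis.mk_apply, LinearMap.comp_apply, LinearMap.comp_apply _ (ext l ∘ₗ _), hB,
        toLin'_apply]
      obtain ⟨i, a, ha⟩ := p
      rcases a with _ | a
      · rw [(hν i).1 ha, map_smul, hB]
        funext j c
        by_cases h : j = i
        · simp [unit_apply, h]
        · simp [unit_apply, h]
      · rw [(hν i).2 a ha, map_add, map_smul, hB, hB]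
        funext j c
        simp only [Pi.add_apply, Pi.smul_apply, unit_apply, jordan_apply, smul_eq_mul,
          Nat.add_right_cancel_iff]
        congr 1
        by_cases h : j = i
        · rw [h]
        · simp [h]
    exact LinearMap.congr_fun this v

end BlockSeq

namespace JordanForm

variable {n : ℕ} {A : Matrix (Fin n) (Fin n) ℂ}

open BlockSeq

/-- Take `v` in `N` with lead at `k - 1` in block `j` and keep only its part `v'` at position `k -
1` of the marked Jordan basis. This part stays in `N`, has the same lead, and can be pulled back by
the power `size j - k` of the nilpotent part, which is depth. -/
lemma hasDeepChains_of_isMarked (F : JordanForm A) {N : Submodule ℂ (Fin n → ℂ)}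
    (hN : N ∈ invariantLattice A) (hm : IsMarked A N) (z : ℂ) : F.HasDeepChains N z := by
  obtain ⟨r, m, c, t, l, b, hc, hb, hcb⟩ := hm
  obtain ⟨ν, φ, hφ, hφb⟩ := exists_isCoord_of_isJordanBasis hb
  -- Since `N` is spanned by members of the basis `b`, it contains every basis vector that occurs in
  -- one of its elements.
  have hNb : ∀ v ∈ N, ∀ p : BlockIdx l, φ v p.1 p.2 ≠ 0 → b p ∈ N := by
    intro v hv
    rw [← hc.2.1] at hv ⊢
    induction hv using Submodule.span_induction with
    | mem x hx =>
      intro p hp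
      obtain ⟨q, rfl⟩ := hcb hx
      rw [hφb, unit_apply] at hp
      have h1 : p = q := by
        refine pos_idx_inj.1 (pos_inj.2 ?_)
        by_contra h'
        simp [h'] at hp
      rw [h1]
      exact Submodule.subset_span hx
    | zero => simp
    | add x y _ _ hx hy =>
      intro p hp
      by_cases h0 : φ x p.1 p.2 = 0
      · exact hy p (by simpa [h0] using hp)
      · exact hx p h0
    | smul a x _ hx =>
      intro p hp
      exact hx p fun h0 => hp (by simp [h0])
  have hmemN : ∀ v, (∀ p : BlockIdx l, φ v p.1 p.2 ≠ 0 → b p ∈ N) → v ∈ N := by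
    intro v hv
    have : v = ∑ p : BlockIdx l, φ v p.1 p.2 • b p := by
      apply hφ.inj
      rw [map_sum]
      funext i a
      simp only [map_smul, hφb, Finset.sum_apply, Pi.smul_apply, unit_apply, smul_eq_mul]
      by_cases ha : a < l i
      · rw [Finset.sum_eq_single ⟨i, a, ha⟩]
        · simp
        · intro q _ hq
          rw [if_neg, mul_zero]
          exact fun h => hq (pos_idx_inj.1 (pos_inj.2 ⟨h.1.symm, h.2.symm⟩))
        · simp
      · rw [hφ.mem_bounded v i a (not_lt.1 ha), Finset.sum_eq_zero]
        rintro ⟨j, q⟩ _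
        rw [if_neg, mul_zero]
        rintro ⟨rfl, rfl⟩
        exact ha q.2
    rw [this]
    refine N.sum_mem fun p _ => ?_
    by_cases h0 : φ v p.1 p.2 = 0
    · rw [h0, zero_smul]
      exact N.zero_mem
    · exact N.smul_mem _ (hv p h0)
  intro j hj hk
  subst hj
  have hF := F.isCoord
  set k := F.chainLength N j with hkdef
  have hkj : k ≤ F.size j := F.chainLength_le hN j
  obtain ⟨_, ⟨v, hv, rfl⟩, hl⟩ := (F.hasProfile hN j (k - 1)).2 (by omega)
  have hvlt : ∀ i a, F.coord v i a ≠ 0 → a < k := fun i a h => by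
    have := pos_le_iff.1 (hl.le i a h)
    omega
  have hv0 := hφ.pow_eq_zero_iff.1
    (hF.pow_eq_zero_iff.2 fun i a h => ⟨hl.eig i a h, hvlt i a h⟩)
  -- the eigenvector is in the image of the power `size j - 1`
  obtain ⟨x, hx⟩ := hF.exists_eq
    (y := fun i a => if a = F.size j - 1 then F.coord v i (k - 1) else 0) (by
      intro i a ha
      dsimp only
      split_ifs with h
      · by_contra hne
        have h1 := pos_le_iff.1 (hl.le i _ hne)
        -- At position `k - 1` only blocks up to `j` occur, and these are at least as long as block
        -- `j`.
        have h2 := F.size_anti i j (by omega) (hl.eig i _ hne)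
        have := F.size_pos j
        omega
      · rfl)
  have hxs : SupportedAt F.eig (F.eig j) (F.coord x) := by
    intro i a h
    rw [hx] at h
    dsimp only at h
    split_ifs at h with h'
    · exact hl.eig _ _ h
    · exact absurd rfl h
  have hxv : ((Matrix.toLin' A - F.eig j • 1 : Module.End ℂ _) ^ (F.size j - 1)) x =
      ((Matrix.toLin' A - F.eig j • 1 : Module.End ℂ _) ^ (k - 1)) v := by
    apply hF.inj
    rw [hF.map_pow hxs, hF.map_pow hl.supportedAt, hx]
    funext i a
    dsimp only
    have := F.size_pos j
    rcases a with _ | a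
    · simp
    · rw [if_neg (by omega)]
      by_contra hne
      have := hvlt _ _ (Ne.symm hne)
      omega
  -- The eigenvector is also reached from `x` by the power `size j - 1`, so every block of the other
  -- basis that it meets is at least that long. This is the room used for `w`.
  have hlen : ∀ i, φ v i (k - 1) ≠ 0 → F.size j ≤ l i := by
    intro i hi
    have h1 := (hv0 i _ hi).1
    have h2 := congrArg (fun w => φ w i 0) hxv
    simp only [hφ.pow_apply h1, zero_add] at h2
    rw [← h2] at hi
    have := lt_of_mem_bounded (hφ.mem_bounded x) hi
    omega
  -- the part of `v` at position `k - 1` of the Jordan basis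
  obtain ⟨v', hv'⟩ := hφ.exists_eq (y := fun i a => if a = k - 1 then φ v i a else 0) (by
    intro i a ha
    dsimp only
    split_ifs with h
    · exact hφ.mem_bounded v i a ha
    · rfl)
  obtain ⟨w, hw⟩ := hφ.exists_eq
    (y := fun i a => if a = F.size j - 1 then φ v i (k - 1) else 0) (by
      intro i a ha
      dsimp only
      split_ifs with h
      · by_contra hne
        have := hlen i hne
        have := F.size_pos j
        omega
      · rfl)
  have hws : SupportedAt ν (F.eig j) (φ w) := by
    intro i a h
    rw [hw] at h
    dsimp only at h
    split_ifs at h with h'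
    · exact (hv0 _ _ h).1
    · exact absurd rfl h
  have hwv : ((Matrix.toLin' A - F.eig j • 1 : Module.End ℂ _) ^ (F.size j - k)) w = v' := by
    apply hφ.inj
    rw [hφ.map_pow hws, hw, hv']
    funext i a
    dsimp only
    have h1 : a + (F.size j - k) = F.size j - 1 ↔ a = k - 1 := by omega
    rw [if_congr h1 rfl rfl]
    split_ifs with h
    · rw [h]
    · rfl
  have hv'N : v' ∈ N := by
    refine hmemN v' fun p hp => hNb v hv p fun h0 => hp ?_
    rw [hv']
    simp [h0]
  -- In the other basis `v' - v` lives below position `k - 1`, so it is killed by that power; read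
  -- in the original coordinates, it cannot disturb the lead.
  have hdiff : ∀ i a, F.coord (v' - v) i a ≠ 0 → F.eig i = F.eig j ∧ a < k - 1 := by
    apply hF.pow_eq_zero_iff.1
    refine hφ.pow_eq_zero_iff.2 fun i a h => ?_
    rw [map_sub, hv'] at h
    simp only [Pi.sub_apply] at h
    split_ifs at h with h'
    · simp at h
    · have := hv0 i a (by simpa using h)
      exact ⟨this.1, by omega⟩
  have hsplit : ∀ i a, F.coord v' i a ≠ 0 → F.coord v i a ≠ 0 ∨ F.coord (v' - v) i a ≠ 0 := by
    intro i a h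
    by_contra! h'
    rw [map_sub, Pi.sub_apply, Pi.sub_apply, h'.1, sub_zero] at h'
    exact h h'.2
  have heig : ∀ i a, F.coord v' i a ≠ 0 → F.eig i = F.eig j := fun i a h =>
    (hsplit i a h).elim (hl.eig i a) fun h' => (hdiff i a h').1
  refine ⟨F.coord v', Submodule.mem_map_of_mem hv'N, ⟨?_, heig, fun i a h => ?_⟩,
    fun i a h => ?_⟩
  · intro h0
    refine absurd (hdiff j (k - 1) ?_).2 (lt_irrefl _)
    rw [map_sub, Pi.sub_apply, Pi.sub_apply, h0, zero_sub, neg_ne_zero]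
    exact hl.ne
  · rcases hsplit i a h with h' | h'
    · exact hl.le i a h'
    · exact pos_le_iff.2 (Or.inl (hdiff i a h').2)
  · have hi := heig i a h
    rw [← hwv, hF.pow_apply hi] at h
    have := lt_of_mem_bounded (hF.mem_bounded w) h
    omega

/-- Over the original sizes the columns of Q T form a Jordan basis of the whole space, and the first
`k i` columns of each block form one of `N`. -/
lemma isMarked_of_represents (F : JordanForm A) {N : Submodule ℂ (Fin n → ℂ)}
    {k : Fin F.u → ℕ} (hk : k ≤ F.size) {T : Matrix (BlockIdx F.size) (BlockIdx F.size) ℂ}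
    (h : BlockSeq.Represents F.size F.eig k T (N.map F.coord)) : IsMarked A N := by
  have hsum : ∀ x : BlockIdx F.size → ℂ, x = ∑ p, x p • Pi.single p (1 : ℂ) := fun x => by
    conv_lhs => rw [← Finset.univ_sum_single x]
    exact Finset.sum_congr rfl fun p _ => by rw [← Pi.single_smul, smul_eq_mul, mul_one]
  let L : (BlockIdx F.size → ℂ) →ₗ[ℂ] (Fin n → ℂ) := (F.Q * T).mulVecLin
  have hL : ∀ x, F.coord (L x) = ext F.size (T *ᵥ x) := fun x => by
    rw [mulVecLin_apply, ← mulVec_mulVec, F.coord_Q_mulVec]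
  have hinv : ∀ x, T⁻¹ *ᵥ (T *ᵥ x) = x := fun x => by
    rw [mulVec_mulVec, h.inv_mul, one_mulVec]
  have hLinj : Function.Injective L := by
    intro x y hxy
    have h1 := congrArg F.coord hxy
    rw [hL, hL] at h1
    rw [← hinv x, ← hinv y, ext_injective _ h1]
  have hLsurj : ∀ v, ∃ x, L x = v := by
    intro v
    refine ⟨T⁻¹ *ᵥ (F.Qinv *ᵥ v), F.isCoord.inj ?_⟩
    rw [hL, mulVec_mulVec _ T, h.mul_inv, one_mulVec, coord_apply]
  let b : BlockIdx F.size → Fin n → ℂ := fun p => L (Pi.single p 1)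
  have hb : LinearIndependent ℂ b := by
    have h1 := (Pi.basisFun ℂ (BlockIdx F.size)).linearIndependent.map' L
      (LinearMap.ker_eq_bot.2 hLinj)
    have h2 : ⇑L ∘ ⇑(Pi.basisFun ℂ (BlockIdx F.size)) = b := by
      funext p
      simp [b]
    rwa [h2] at h1
  have hstep : ∀ (j : Fin F.u) (a : ℕ) (ha : a < F.size j), A *ᵥ b ⟨j, a, ha⟩ =
      F.eig j • b ⟨j, a, ha⟩ + if h : 0 < a then b ⟨j, a - 1, by omega⟩ else 0 := by
    intro j a ha
    apply F.isCoord.inj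
    rw [← toLin'_apply, F.isCoord.map, hL, ← (isCoord_ext F.size F.eig).map, toLin'_apply,
      mulVec_mulVec, ← h.2.1.eq, ← mulVec_mulVec, jordanMatrix_mulVec_single, mulVec_add,
      mulVec_smul, map_add, map_smul, map_add, map_smul, hL]
    congr 1
    split_ifs
    · rw [hL]
    · simp
  let e : BlockIdx k → BlockIdx F.size := fun p => ⟨p.1, p.2, p.2.2.trans_le (hk p.1)⟩
  have he : Function.Injective e := by
    intro p q hpq
    have h1 := pos_idx_inj.2 hpq
    exact pos_idx_inj.1 h1
  refine ⟨F.u, k, b ∘ e, F.u, F.size, b,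
    ⟨hb.comp e he, le_antisymm ?_ ?_, F.eig, fun i => ⟨?_, ?_⟩⟩,
    ⟨hb, eq_top_iff.2 ?_, F.eig, fun i => ⟨?_, ?_⟩⟩, Set.range_comp_subset_range e b⟩
  · rw [Submodule.span_le]
    rintro _ ⟨p, rfl⟩
    have h1 : F.coord (b (e p)) ∈ N.map F.coord := by
      rw [hL, h.mulVec_mem_iff, ext_single]
      intro i a ha
      rw [unit_apply, if_neg]
      rintro ⟨rfl, rfl⟩
      exact absurd ha (not_le.2 p.2.2)
    obtain ⟨v, hv, hvb⟩ := h1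
    rw [F.isCoord.inj hvb] at hv
    exact hv
  · intro v hv
    obtain ⟨x, hx, hxv⟩ := h.exists_eq (Submodule.mem_map_of_mem hv)
    rw [← hL] at hxv
    rw [← F.isCoord.inj hxv, hsum x, map_sum]
    refine Submodule.sum_mem _ fun p _ => ?_
    rw [map_smul]
    by_cases h0 : x p = 0
    · rw [h0, zero_smul]
      exact Submodule.zero_mem _
    · refine Submodule.smul_mem _ _ (Submodule.subset_span ?_)
      rw [← ext_apply_fin x p] at h0
      exact ⟨⟨p.1, p.2, lt_of_mem_bounded hx h0⟩, rfl⟩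
  · intro h0
    have := hstep i 0 (h0.trans_le (hk i))
    simpa using this
  · intro a ha
    have := hstep i (a + 1) (ha.trans_le (hk i))
    simpa using this
  · intro v _
    obtain ⟨x, rfl⟩ := hLsurj v
    rw [hsum x, map_sum]
    refine Submodule.sum_mem _ fun p _ => ?_
    rw [map_smul]
    exact Submodule.smul_mem _ _ (Submodule.subset_span ⟨p, rfl⟩)
  · intro h0
    have := hstep i 0 h0
    simpa using this
  · intro a ha
    have := hstep i (a + 1) ha
    simpa using this

lemma isMarked_iff (F : JordanForm A) {N : Submodule ℂ (Fin n → ℂ)}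
    (hN : N ∈ invariantLattice A) : IsMarked A N ↔ ∀ z, F.HasDeepChains N z := by
  refine ⟨fun h z => F.hasDeepChains_of_isMarked hN h z, fun h => ?_⟩
  have h1 := F.exists_represents hN (E := ∅) fun z _ => h z
  rw [exists_represents_iff, F.expandedSize_empty] at h1
  obtain ⟨T, hT⟩ := h1
  exact F.isMarked_of_represents (F.chainLength_le hN) hT

/-- The component of `N` at `z` has the leads of `N` in the blocks of `z` and none elsewhere, so its
depth at other eigenvalues is vacuous. -/
lemma mem_nonMarkedEigenvalues_iff (F : JordanForm A) {N : Submodule ℂ (Fin n → ℂ)}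
    (hN : N ∈ invariantLattice A) {z : ℂ} :
    z ∈ nonMarkedEigenvalues A N ↔ ¬ F.HasDeepChains N z := by
  set M := N ⊓ Module.End.maxGenEigenspace (Matrix.toLin' A) z with hM
  have hMinv : M ∈ invariantLattice A := by
    intro v hv
    refine ⟨hN hv.1, ?_⟩
    exact Module.End.mapsTo_maxGenEigenspace_of_comm (Commute.refl _) z hv.2
  have hmem : ∀ y, y ∈ M.map F.coord ↔ y ∈ N.map F.coord ∧ SupportedAt F.eig z y := by
    intro y
    constructor
    · rintro ⟨v, hv, rfl⟩
      exact ⟨Submodule.mem_map_of_mem hv.1, F.isCoord.mem_maxGenEigenspace_iff.1 hv.2⟩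
    · rintro ⟨⟨v, hv, rfl⟩, h⟩
      exact Submodule.mem_map_of_mem ⟨hv, F.isCoord.mem_maxGenEigenspace_iff.2 h⟩
  have hlen : ∀ j, F.eig j = z → F.chainLength M j = F.chainLength N j := by
    intro j hj
    have h1 : ∀ a, a < F.chainLength M j ↔ a < F.chainLength N j := by
      intro a
      rw [← F.hasProfile hMinv, ← F.hasProfile hN]
      refine exists_congr fun y => ?_
      rw [hmem]
      exact ⟨fun h => ⟨h.1.1, h.2⟩, fun h => ⟨⟨h.1, hj ▸ h.2.supportedAt⟩, h.2⟩⟩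
    have h2 := h1 (F.chainLength M j)
    have h3 := h1 (F.chainLength N j)
    omega
  unfold nonMarkedEigenvalues
  rw [Set.mem_ofPred_eq, F.isMarked_iff hMinv, not_iff_not]
  constructor
  · intro h j hj hk
    obtain ⟨y, hy, hl, hd⟩ := h z j hj (by rwa [hlen j hj])
    rw [hlen j hj] at hl hd
    exact ⟨y, ((hmem y).1 hy).1, hl, hd⟩
  · intro h w j hj hk
    obtain ⟨y, hy, hl⟩ := (F.hasProfile hMinv j (F.chainLength M j - 1)).2 (by omega)
    have hz := ((hmem y).1 hy).2 _ _ hl.ne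
    rw [hlen j hz] at hk ⊢
    obtain ⟨y', hy', hl', hd'⟩ := h j hz hk
    exact ⟨y', (hmem y').2 ⟨hy', hz ▸ hl'.supportedAt⟩, hl', hd'⟩

lemma isMarked_iff_nonMarkedEigenvalues (F : JordanForm A) {N : Submodule ℂ (Fin n → ℂ)}
    (hN : N ∈ invariantLattice A) : IsMarked A N ↔ nonMarkedEigenvalues A N = ∅ := by
  rw [F.isMarked_iff hN, Set.eq_empty_iff_forall_notMem]
  refine forall_congr' fun z => ?_
  rw [F.mem_nonMarkedEigenvalues_iff hN, not_not]

end JordanForm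

/-! ### Linked subspaces, change of powers and dimension. -/

namespace BlockSeq

variable {u : ℕ}

/-- The families in which, from position `k i` on, the entries of a block `i` in `S` are copied
from block `J i`, with the positions moved by `d i`, and those of the other blocks vanish. -/
def linked (S : Set (Fin u)) (J : Fin u → Fin u) (d k : Fin u → ℕ) :
    Submodule ℂ (BlockSeq u) where
  carrier := {v | ∀ i a, k i ≤ a → (i ∈ S → v i a = v (J i) (a + d i)) ∧ (i ∉ S → v i a = 0)}
  add_mem' {v w} hv hw i a ha :=
    ⟨fun h => by simp [(hv i a ha).1 h, (hw i a ha).1 h],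
      fun h => by simp [(hv i a ha).2 h, (hw i a ha).2 h]⟩
  zero_mem' _ _ _ := ⟨fun _ => rfl, fun _ => rfl⟩
  smul_mem' c v hv i a ha :=
    ⟨fun h => by simp [(hv i a ha).1 h], fun h => by simp [(hv i a ha).2 h]⟩

open Classical in
/-- The vector of `linked S J d k` that belongs to position `a` of block `j`. -/
noncomputable def linkedUnit (S : Set (Fin u)) (J : Fin u → Fin u) (d k : Fin u → ℕ) (j : Fin u)
    (a : ℕ) : BlockSeq u := fun i b =>
  if i = j ∧ b = a ∨ i ∈ S ∧ J i = j ∧ b + d i = a ∧ k i ≤ b then 1 else 0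

section Linked

variable {S : Set (Fin u)} {J : Fin u → Fin u} {d k s : Fin u → ℕ} {μ : Fin u → ℂ}

lemma linkedUnit_ne_zero {j i : Fin u} {a b : ℕ} (h : linkedUnit S J d k j a i b ≠ 0) :
    i = j ∧ b = a ∨ i ∈ S ∧ J i = j ∧ b + d i = a ∧ k i ≤ b := by
  by_contra h'
  exact h (if_neg h')

lemma linked_le_bounded (hk : k ≤ s) (hJ : ∀ i ∈ S, J i ∉ S)
    (hd : ∀ i ∈ S, k (J i) ≤ s i + d i) : linked S J d k ≤ bounded s := by
  intro v hv i a ha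
  by_cases hi : i ∈ S
  · rw [(hv i a ((hk i).trans ha)).1 hi]
    exact (hv _ _ ((hd i hi).trans (Nat.add_le_add_right ha _))).2 (hJ i hi)
  · exact (hv i a ((hk i).trans ha)).2 hi

lemma jordan_mem_linked (hμ : ∀ i ∈ S, μ (J i) = μ i) (v : BlockSeq u)
    (hv : v ∈ linked S J d k) : jordan μ v ∈ linked S J d k := by
  intro i a ha
  have h1 := hv i a ha
  have h2 := hv i (a + 1) (by omega)
  refine ⟨fun hi => ?_, fun hi => ?_⟩
  · rw [jordan_apply, jordan_apply, h1.1 hi, h2.1 hi, hμ i hi,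
      show a + 1 + d i = a + d i + 1 by omega]
  · rw [jordan_apply, h1.2 hi, h2.2 hi, mul_zero, zero_add]

lemma linkedUnit_mem (hJ : ∀ i ∈ S, J i ∉ S) {j : Fin u} {a : ℕ} (ha : a < k j) :
    linkedUnit S J d k j a ∈ linked S J d k := by
  intro i b hb
  have h1 : ¬ (i = j ∧ b = a) := by
    rintro ⟨rfl, rfl⟩
    omega
  refine ⟨fun hi => ?_, fun hi => ?_⟩
  · unfold linkedUnit
    congr 1
    simp [hi, hJ i hi, h1, hb]
  · unfold linkedUnit
    rw [if_neg]
    simp [hi, h1]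

lemma hasLead_linkedUnit (hμ : ∀ i ∈ S, μ (J i) = μ i) (hd : ∀ i ∈ S, 0 < d i) (j : Fin u)
    (a : ℕ) : HasLead μ j a (linkedUnit S J d k j a) where
  ne := by simp [linkedUnit]
  eig i b h := by
    rcases linkedUnit_ne_zero h with ⟨rfl, -⟩ | ⟨hi, rfl, -⟩
    · rfl
    · exact (hμ i hi).symm
  le i b h := by
    rw [pos_le_iff]
    rcases linkedUnit_ne_zero h with ⟨rfl, rfl⟩ | ⟨hi, rfl, h', -⟩
    · exact Or.inr ⟨rfl, le_rfl⟩
    · have := hd i hi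
      omega

/-- An entry copied into block `i` comes from a strictly higher position since `d i > 0`, so copying
creates no new leads. -/
lemma hasProfile_linked (hμ : ∀ i ∈ S, μ (J i) = μ i) (hJ : ∀ i ∈ S, J i ∉ S)
    (hd : ∀ i ∈ S, 0 < d i) : HasProfile μ (linked S J d k) k := by
  intro j a
  constructor
  · rintro ⟨v, hv, hl⟩
    by_contra! ha
    by_cases hj : j ∈ S
    · have h1 := hl.ne
      rw [(hv j a ha).1 hj] at h1
      have h2 := pos_le_iff.1 (hl.le _ _ h1)
      have := hd j hj
      omega
    · exact hl.ne ((hv j a ha).2 hj)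
  · exact fun ha => ⟨_, linkedUnit_mem hJ ha, hasLead_linkedUnit hμ hd j a⟩

end Linked

lemma bounded_represents {s r : Fin u → ℕ} (μ : Fin u → ℂ) (hr : r ≤ s) :
    Represents s μ r 1 (bounded r) := by
  refine ⟨isUnit_one, Commute.one_left _, fun i j hi hj hij => ?_, ?_⟩
  · rw [Matrix.one_apply_ne]
    intro h
    rw [Sigma.mk.injEq] at h
    exact hij.ne' h.1
  · ext y
    constructor
    · intro hy
      obtain ⟨x, rfl⟩ := exists_ext_eq (bounded_mono hr hy)
      exact ⟨x, mem_ker_mul_inv.2 (by rwa [inv_one, one_mulVec]), rfl⟩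
    · rintro ⟨x, hx, rfl⟩
      have := mem_ker_mul_inv.1 hx
      rwa [inv_one, one_mulVec] at this

lemma Represents.mono {s k l : Fin u → ℕ} {μ : Fin u → ℂ}
    {T : Matrix (BlockIdx s) (BlockIdx s) ℂ} {N M : Submodule ℂ (BlockSeq u)}
    (h : Represents s μ k T N) (h' : Represents s μ l T M) (hkl : k ≤ l) : N ≤ M := by
  intro y hy
  obtain ⟨x, hx, rfl⟩ := h.exists_eq hy
  exact (h'.mulVec_mem_iff x).2 (bounded_mono hkl hx)

lemma Represents.change {s k : Fin u → ℕ} {μ : Fin u → ℂ}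
    {T : Matrix (BlockIdx s) (BlockIdx s) ℂ} {N : Submodule ℂ (BlockSeq u)}
    (h : Represents s μ k T N) (l : Fin u → ℕ) :
    ∃ M, Represents s μ l T M :=
  ⟨_, h.1, h.2.1, h.2.2.1, rfl⟩

lemma finrank_bounded (k : Fin u → ℕ) : Module.finrank ℂ (bounded k) = ∑ i, k i := by
  rw [← (isCoord_ext k 0).range_eq, LinearMap.finrank_range_of_inj (ext_injective k),
    Module.finrank_fintype_fun_eq_card]
  simp

lemma Represents.finrank_eq {s k : Fin u → ℕ} {μ : Fin u → ℂ}
    {T : Matrix (BlockIdx s) (BlockIdx s) ℂ} {N : Submodule ℂ (BlockSeq u)}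
    (h : Represents s μ k T N) (hk : k ≤ s) : Module.finrank ℂ N = ∑ i, k i := by
  have hW : ((bounded k).comap (ext s)).map (ext s) = bounded k :=
    (isCoord_ext s μ).map_comap (bounded_mono hk)
  have hT : Function.Injective T.mulVecLin := by
    intro x y hxy
    have := congrArg (T⁻¹ *ᵥ ·) hxy
    simpa [mulVec_mulVec, h.inv_mul] using this
  have hN : N = (((bounded k).comap (ext s)).map T.mulVecLin).map (ext s) := by
    ext y
    constructor
    · intro hy
      obtain ⟨x, hx, rfl⟩ := h.exists_eq hy
      exact ⟨_, ⟨x, hx, rfl⟩, rfl⟩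
    · rintro ⟨_, ⟨x, hx, rfl⟩, rfl⟩
      exact (h.mulVec_mem_iff x).2 hx
  rw [hN, ← finrank_bounded, ← (Submodule.equivMapOfInjective _ (ext_injective s) _).finrank_eq,
    ← (Submodule.equivMapOfInjective _ hT _).finrank_eq,
    (Submodule.equivMapOfInjective _ (ext_injective s) _).finrank_eq, hW]

end BlockSeq

/-! ### Gaps and the matrices of refined types. -/

namespace JordanForm

variable {n : ℕ} {A : Matrix (Fin n) (Fin n) ℂ}

open BlockSeq

/-- If `N` is not marked at `z`, then two blocks with eigenvalue `z` differ in size and in chain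
length by more than one. -/
lemma exists_gap (F : JordanForm A) {N : Submodule ℂ (Fin n → ℂ)} (hN : N ∈ invariantLattice A)
    {z : ℂ} (hz : ¬ F.HasDeepChains N z) :
    ∃ i j, F.eig i = z ∧ F.eig j = z ∧ F.chainLength N i < F.size i ∧
      F.chainLength N j < F.size j ∧ F.size i + 1 < F.size j ∧
      F.chainLength N i + 1 < F.chainLength N j := by
  by_contra hno
  push Not at hno
  refine hz fun j hj hk => ?_
  have hprof := F.hasProfile hN
  have hle := F.chainLength_le hN j
  set k := F.chainLength N with hkdef
  obtain ⟨y, hy, hl⟩ := (hprof j (k j - 1)).2 (by omega)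
  -- Everything below the lead is reduced modulo `N`: apart from the lead, `y - w` has entries only
  -- at positions `b ≥ k i`.
  obtain ⟨w, hwN, hwz, hwp, hw⟩ := exists_reduction (fun j a => (hprof j a).2) z (pos j (k j - 1))
    (y - y j (k j - 1) • unit j (k j - 1))
    (fun i b h => by
      by_cases h1 : y i b = 0
      · have h2 : unit j (k j - 1) i b ≠ 0 := fun h2 => h (by simp [h1, h2])
        exact ((hasLead_unit F.eig j (k j - 1)).eig i b h2).trans hj
      · exact (hl.eig i b h1).trans hj)
    (fun i b h => by
      have h1 : pos i b ≠ pos j (k j - 1) := by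
        intro h'
        obtain ⟨rfl, rfl⟩ := pos_inj.1 h'
        simp [unit_apply] at h
      refine lt_of_le_of_ne ?_ h1
      by_cases h2 : y i b = 0
      · have h3 : unit j (k j - 1) i b ≠ 0 := fun h3 => h (by simp [h2, h3])
        exact (hasLead_unit F.eig j (k j - 1)).le i b h3
      · exact hl.le i b h2)
  have hwj : w j (k j - 1) = 0 := by
    by_contra h
    exact lt_irrefl _ (hwp _ _ h)
  have hzero : ∀ i b, b < k i → ¬ (i = j ∧ b = k j - 1) → (y - w) i b = 0 := by
    intro i b hb hij
    have := hw i b hb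
    rw [Pi.sub_apply, Pi.sub_apply, Pi.smul_apply, Pi.smul_apply, unit_apply, if_neg hij,
      smul_zero, sub_zero] at this
    rw [Pi.sub_apply, Pi.sub_apply, this, sub_self]
  have hpos : ∀ i b, (y - w) i b ≠ 0 → pos i b ≤ pos j (k j - 1) := by
    intro i b h
    by_cases h1 : y i b = 0
    · exact (hwp i b fun h2 => h (by simp [h1, h2])).le
    · exact hl.le i b h1
  have hyw : y - w ∈ N.map F.coord := Submodule.sub_mem _ hy hwN
  have heig : ∀ i b, (y - w) i b ≠ 0 → F.eig i = F.eig j := by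
    intro i b h
    by_cases h1 : y i b = 0
    · exact (hwz i b fun h2 => h (by simp [h1, h2])).trans hj.symm
    · exact hl.eig i b h1
  refine ⟨y - w, hyw, ⟨?_, heig, hpos⟩, fun i b h => ?_⟩
  · rw [Pi.sub_apply, Pi.sub_apply, hwj, sub_zero]
    exact hl.ne
  · have hb := lt_of_mem_bounded (F.isCoord.map_le N hyw) h
    by_cases hij : i = j ∧ b = k j - 1
    · rw [hij.1, hij.2]
      omega
    · have hkb : k i ≤ b := by
        by_contra! h'
        exact h (hzero i b h' hij)
      have h1 := pos_le_iff.1 (hpos i b h)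
      have h2 := hno i j ((heig i b h).trans hj) hj
      -- An entry violating depth would have `k i ≤ b < size i` and `b < k j - 1`. With sizes
      -- differing by more than one and `k j < size j` this is precisely an excluded gap; the other
      -- cases are deep by counting.
      by_cases h3 : F.size i < F.size j
      · have h4 := F.lt_of_size_lt (heig i b h) h3
        by_cases h5 : k j < F.size j
        · have h6 := h2 (by omega) h5
          by_cases h7 : F.size i + 1 < F.size j
          · have h8 := h6 h7
            omega
          · omega
        · omega
      · omega

/-- If expansion at `z` changes no size, the sizes at `z` already differ by at most one, and then no
invariant subspace fails to be marked there. So the block sizes determine the set of non-marked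
eigenvalues. -/
lemma subset_of_expandedSize_eq (F : JordanForm A) {N : Submodule ℂ (Fin n → ℂ)}
    (hN : N ∈ invariantLattice A) {E : Set ℂ}
    (h : F.expandedSize (nonMarkedEigenvalues A N) = F.expandedSize E) :
    nonMarkedEigenvalues A N ⊆ E := by
  intro z hz
  by_contra hzE
  refine (F.mem_nonMarkedEigenvalues_iff hN).1 hz (F.hasDeepChains_of_size hN ?_)
  intro i j hi hj
  have h1 := congrFun h i
  rw [F.expandedSize_of_mem (hi.symm ▸ hz), F.expandedSize_of_notMem (hi.symm ▸ hzE), hi] at h1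
  have h2 := F.size_le_maxSize hj
  omega

lemma sigma_shiftMatrix_inj {u : ℕ} {s t k l : Fin u → ℕ} (hk : k ≤ s) (hl : l ≤ t)
    (h : (⟨s, shiftMatrix s k⟩ : Σ s : Fin u → ℕ, Matrix (BlockIdx s) (BlockIdx s) ℂ) =
      ⟨t, shiftMatrix t l⟩) : s = t ∧ k = l := by
  rw [Sigma.mk.injEq] at h
  obtain ⟨rfl, h⟩ := h
  exact ⟨rfl, shiftMatrix_injOn hk hl (eq_of_heq h)⟩

lemma produces_iff (F : JordanForm A) {N : Submodule ℂ (Fin n → ℂ)} (hN : N ∈ invariantLattice A)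
    (Z : Σ s : Fin F.u → ℕ, Matrix (BlockIdx s) (BlockIdx s) ℂ) :
    F.Produces N Z ↔ Z = ⟨F.expandedSize (nonMarkedEigenvalues A N),
      shiftMatrix _ (F.chainLength N)⟩ := by
  constructor
  · rintro ⟨k, hk, ⟨T, hT⟩, rfl⟩
    rw [F.chainLength_eq_of_represents hk hT]
  · rintro rfl
    refine ⟨_, F.chainLength_le hN, F.exists_represents hN fun z hz => ?_, rfl⟩
    rwa [F.mem_nonMarkedEigenvalues_iff hN, not_not] at hz

lemma produces_size_iff (F : JordanForm A) {N : Submodule ℂ (Fin n → ℂ)}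
    (hN : N ∈ invariantLattice A) {r : Fin F.u → ℕ} (hr : r ≤ F.size) :
    F.Produces N ⟨F.size, shiftMatrix F.size r⟩ ↔
      nonMarkedEigenvalues A N = ∅ ∧ F.chainLength N = r := by
  rw [F.produces_iff hN]
  constructor
  · intro h
    obtain ⟨h1, h2⟩ := sigma_shiftMatrix_inj hr
      ((F.chainLength_le hN).trans (F.size_le_expandedSize _)) h
    refine ⟨Set.subset_empty_iff.1 (F.subset_of_expandedSize_eq hN ?_), h2.symm⟩
    rw [← h1, expandedSize_empty]
  · rintro ⟨h1, rfl⟩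
    rw [h1, expandedSize_empty]

/-- The subspace spanned by the first `r i` vectors of each block `i`. -/
def initial (F : JordanForm A) (r : Fin F.u → ℕ) : Submodule ℂ (Fin n → ℂ) :=
  (bounded r).comap F.coord

lemma map_initial (F : JordanForm A) {r : Fin F.u → ℕ} (hr : r ≤ F.size) :
    (F.initial r).map F.coord = bounded r :=
  F.isCoord.map_comap (bounded_mono hr)

lemma eq_initial_iff (F : JordanForm A) {r : Fin F.u → ℕ} (hr : r ≤ F.size)
    {N : Submodule ℂ (Fin n → ℂ)} : N = F.initial r ↔ N.map F.coord = bounded r := by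
  rw [← F.map_initial hr]
  exact (Submodule.map_injective_of_injective F.isCoord.inj).eq_iff.symm

lemma initial_mem (F : JordanForm A) (r : Fin F.u → ℕ) : F.initial r ∈ invariantLattice A := by
  intro v hv
  change F.coord (Matrix.toLin' A v) ∈ bounded r
  rw [F.isCoord.map]
  exact jordan_mem_bounded _ hv

lemma initial_represents (F : JordanForm A) {r : Fin F.u → ℕ} (hr : r ≤ F.size) (E : Set ℂ) :
    F.Represents E r 1 (F.initial r) := by
  rw [represents_iff, F.map_initial hr]
  exact bounded_represents _ (hr.trans (F.size_le_expandedSize E))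

lemma chainLength_initial (F : JordanForm A) {r : Fin F.u → ℕ} (hr : r ≤ F.size) :
    F.chainLength (F.initial r) = r :=
  F.chainLength_eq_of_represents hr (F.initial_represents hr ∅)

lemma nonMarkedEigenvalues_eq_empty (F : JordanForm A) {N : Submodule ℂ (Fin n → ℂ)}
    {k : Fin F.u → ℕ} (hk : k ≤ F.size) (h : ∃ T, F.Represents ∅ k T N) :
    nonMarkedEigenvalues A N = ∅ := by
  have hN : N ∈ invariantLattice A := by
    obtain ⟨T, hT⟩ := h
    exact F.mem_invariantLattice_of_represents hT
  rw [exists_represents_iff, F.expandedSize_empty] at h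
  obtain ⟨T, hT⟩ := h
  exact (F.isMarked_iff_nonMarkedEigenvalues hN).1 (F.isMarked_of_represents hk hT)

lemma initial_produces (F : JordanForm A) {r : Fin F.u → ℕ} (hr : r ≤ F.size) :
    F.Produces (F.initial r) ⟨F.size, shiftMatrix F.size r⟩ :=
  (F.produces_size_iff (F.initial_mem r) hr).2
    ⟨F.nonMarkedEigenvalues_eq_empty hr ⟨1, F.initial_represents hr ∅⟩, F.chainLength_initial hr⟩

lemma initial_inf (F : JordanForm A) (r q : Fin F.u → ℕ) :
    F.initial (r ⊓ q) = F.initial r ⊓ F.initial q := by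
  ext v
  constructor
  · exact fun h => ⟨bounded_mono inf_le_left h, bounded_mono inf_le_right h⟩
  · intro h i a ha
    rcases inf_le_iff.1 ha with h' | h'
    · exact h.1 i a h'
    · exact h.2 i a h'

lemma initial_sup (F : JordanForm A) {r q : Fin F.u → ℕ} (hr : r ≤ F.size) (hq : q ≤ F.size) :
    F.initial (r ⊔ q) = F.initial r ⊔ F.initial q := by
  symm
  rw [F.eq_initial_iff (sup_le hr hq), Submodule.map_sup, F.map_initial hr, F.map_initial hq]
  refine le_antisymm (sup_le (bounded_mono le_sup_left) (bounded_mono le_sup_right)) ?_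
  intro v hv
  rw [Submodule.mem_sup]
  refine ⟨fun i a => if a < r i then v i a else 0, fun i a ha => if_neg (not_lt.2 ha),
    fun i a => if a < r i then 0 else v i a, fun i a ha => ?_, ?_⟩
  · dsimp only
    split_ifs with h
    · rfl
    · exact hv i a (sup_le (not_lt.1 h) ha)
  · funext i a
    simp only [Pi.add_apply]
    split_ifs <;> simp

/-- All combinations of powers and eigenvalues that the explicit list permits occur. -/
lemma exists_of_gaps (F : JordanForm A) {k : Fin F.u → ℕ} (hk : k ≤ F.size) {E : Set ℂ}
    (hE : ∀ z ∈ E, ∃ i j, F.eig i = z ∧ F.eig j = z ∧ k i < F.size i ∧ k j < F.size j ∧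
      F.size i + 1 < F.size j ∧ k i + 1 < k j) :
    ∃ N ∈ invariantLattice A, F.chainLength N = k ∧ nonMarkedEigenvalues A N = E := by
  classical
  choose I J hI hJ hkI hkJ hs hkk using hE
  have hIcongr : ∀ z w (hz : z ∈ E) (hw : w ∈ E), z = w → I z hz = I w hw := by
    rintro z w hz hw rfl
    rfl
  -- One short block for each eigenvalue in `E`; `P` sends it to its long partner.
  let S : Set (Fin F.u) := {i | ∃ h : F.eig i ∈ E, I _ h = i}
  let P : Fin F.u → Fin F.u := fun i => if h : F.eig i ∈ E then J _ h else i
  -- The least positive displacement for which the copied entries fit into block `i`. The gap in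
  -- powers keeps part of the chain copied, and the gap in sizes makes the copy too high to be deep.
  let d : Fin F.u → ℕ := fun i => max 1 (k (P i) - F.size i)
  have hS : ∀ i ∈ S, F.eig i ∈ E ∧ F.eig (P i) = F.eig i ∧ k i < F.size i ∧
      k (P i) < F.size (P i) ∧ F.size i + 1 < F.size (P i) ∧ k i + 1 < k (P i) := by
    rintro i ⟨h, hi⟩
    have hP : P i = J _ h := dif_pos h
    rw [hP]
    have h1 := hkI _ h
    have h2 := hs _ h
    have h3 := hkk _ h
    rw [hi] at h1 h2 h3
    exact ⟨h, hJ _ h, h1, hkJ _ h, h2, h3⟩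
  have hSP : ∀ i ∈ S, P i ∉ S := by
    rintro i hi ⟨h, hP⟩
    obtain ⟨h', hi'⟩ := hi
    have h1 := hS i ⟨h', hi'⟩
    rw [hIcongr _ _ h h' h1.2.1, hi'] at hP
    rw [← hP] at h1
    omega
  have hμ : ∀ i ∈ S, F.eig (P i) = F.eig i := fun i hi => (hS i hi).2.1
  have hd : ∀ i ∈ S, 0 < d i ∧ k i + d i + 1 ≤ k (P i) ∧ k (P i) ≤ F.size i + d i ∧
      F.size i + 1 + d i ≤ F.size (P i) := by
    intro i hi
    have h1 := hS i hi
    simp only [d]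
    omega
  have hle : linked S P d k ≤ bounded F.size :=
    linked_le_bounded hk hSP fun i hi => (hd i hi).2.2.1
  have hmap := F.isCoord.map_comap hle
  set N := (linked S P d k).comap F.coord with hNdef
  have hN : N ∈ invariantLattice A :=
    F.isCoord.mem_invtSubmodule (by rw [hmap]; exact jordan_mem_linked hμ)
  have hprof : F.chainLength N = k := (F.hasProfile hN).unique
    (hmap.symm ▸ hasProfile_linked hμ hSP fun i hi => (hd i hi).1)
  refine ⟨N, hN, hprof, ?_⟩
  ext z
  rw [F.mem_nonMarkedEigenvalues_iff hN]
  constructor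
  · intro hz
    by_contra hzE
    refine hz fun j hj hkj => ?_
    rw [hprof] at hkj ⊢
    refine ⟨_, hmap.symm ▸ linkedUnit_mem hSP (show k j - 1 < k j by omega),
      hasLead_linkedUnit hμ (fun i hi => (hd i hi).1) j _, fun i a h => ?_⟩
    rcases linkedUnit_ne_zero h with ⟨rfl, rfl⟩ | ⟨hi, rfl, -⟩
    · omega
    · exact absurd ((hμ i hi).symm.trans hj ▸ (hS i hi).1) hzE
  · intro hz hdeep
    have hi : I z hz ∈ S := ⟨(hI z hz).symm ▸ hz, hIcongr _ _ _ _ (hI z hz)⟩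
    set i := I z hz
    have h1 := hS i hi
    have h2 := hd i hi
    -- The lead of any such `y` is copied to position `k (P i) - 1 - d i` of block `i`; depth there
    -- would require `size (P i) ≤ size i + d i`.
    obtain ⟨y, hy, hl, hdp⟩ := hdeep (P i) (h1.2.1.trans (hI z hz)) (by rw [hprof]; omega)
    rw [hprof] at hl hdp
    rw [hmap] at hy
    have h3 := (hy i (k (P i) - 1 - d i) (by omega)).1 hi
    rw [Nat.sub_add_cancel (by omega)] at h3
    have h4 := hdp i _ (h3.trans_ne hl.ne)
    omega

/-! ### Hyperinvariant subspaces. -/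

lemma mem_hyperinvariantLattice {N : Submodule ℂ (Fin n → ℂ)} :
    N ∈ hyperinvariantLattice A ↔ ∀ B, Commute A B → N ∈ invariantLattice B := by
  unfold hyperinvariantLattice
  rw [Sublattice.mem_iInf]
  exact ⟨fun h B hB => h ⟨B, hB⟩, fun h B => h B.1 B.2⟩

/-- The initial subspaces of hyperinvariant powers are preserved by the matrices that commute with
the Jordan matrix. -/
lemma mulVec_mem_bounded (F : JordanForm A) {r : Fin F.u → ℕ} (hr : r ∈ F.hyperPowers)
    {C : Matrix (BlockIdx F.size) (BlockIdx F.size) ℂ}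
    (hC : Commute C (jordanMatrix F.size F.eig)) {x : BlockIdx F.size → ℂ}
    (hx : ext F.size x ∈ bounded r) : ext F.size (C *ᵥ x) ∈ bounded r := by
  obtain ⟨hr1, hr2⟩ := hr
  intro j b hb
  by_contra hne
  have hbs := lt_of_mem_bounded (ext_mem_bounded _ _) hne
  rw [ext_apply_of_lt _ hbs] at hne
  obtain ⟨⟨i, a⟩, -, hq⟩ := Finset.exists_ne_zero_of_sum_ne_zero hne
  obtain ⟨h1, h2, h3⟩ := commute_entry hC (left_ne_zero_of_mul hq)
  have h4 := right_ne_zero_of_mul hq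
  rw [← ext_apply_fin x] at h4
  have h5 := lt_of_mem_bounded hx h4
  dsimp only at h1 h2 h3 h5
  have h6 := hr1 i
  have h7 := hr1 j
  -- Moving to a block on the right is controlled by `size - r`, moving to one on the left by `r`.
  rcases le_total i j with hij | hij
  · have h8 := hr2 i j hij h1.symm
    omega
  · have h8 := hr2 j i hij h1
    omega

lemma initial_mem_hyperinvariantLattice (F : JordanForm A) {r : Fin F.u → ℕ}
    (hr : r ∈ F.hyperPowers) : F.initial r ∈ hyperinvariantLattice A := by
  rw [mem_hyperinvariantLattice]
  intro B hB v hv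
  change ext F.size (F.Qinv *ᵥ (Matrix.toLin' B v)) ∈ bounded r
  have h1 : Commute (F.Qinv * B * F.Q) (jordanMatrix F.size F.eig) := by
    have hJ : jordanMatrix F.size F.eig = F.Qinv * A * F.Q := by
      have h : F.Qinv * (F.Q * jordanMatrix F.size F.eig * F.Qinv) * F.Q =
          jordanMatrix F.size F.eig := by
        rw [← Matrix.mul_assoc, ← Matrix.mul_assoc, F.Qinv_mul_Q, Matrix.one_mul,
          Matrix.mul_assoc, F.Qinv_mul_Q, Matrix.mul_one]
      rw [← F.eq_conj] at h
      exact h.symm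
    have hprod : ∀ X Y : Matrix (Fin n) (Fin n) ℂ,
        F.Qinv * X * F.Q * (F.Qinv * Y * F.Q) = F.Qinv * (X * Y) * F.Q := fun X Y => by
      calc F.Qinv * X * F.Q * (F.Qinv * Y * F.Q)
          = F.Qinv * X * (F.Q * F.Qinv) * Y * F.Q := by simp only [Matrix.mul_assoc]
        _ = F.Qinv * (X * Y) * F.Q := by
            rw [F.Q_mul_Qinv, Matrix.mul_one]; simp only [Matrix.mul_assoc]
    rw [hJ]
    change _ * _ = _ * _
    rw [hprod, hprod, hB.eq]
  have h2 : F.Qinv *ᵥ (Matrix.toLin' B v) = (F.Qinv * B * F.Q) *ᵥ (F.Qinv *ᵥ v) := by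
    rw [toLin'_apply, mulVec_mulVec, mulVec_mulVec, Matrix.mul_assoc _ F.Q, F.Q_mul_Qinv,
      Matrix.mul_one]
  rw [h2]
  exact F.mulVec_mem_bounded hr h1 hv

/-- A hyperinvariant subspace contains with a vector its images under the maps that move one block
to another one with the same eigenvalue. -/
lemma move_mem (F : JordanForm A) {N : Submodule ℂ (Fin n → ℂ)}
    (hN : N ∈ hyperinvariantLattice A) {i j : Fin F.u} (hij : F.eig i = F.eig j) {c : ℕ}
    (hc : F.size i ≤ c + F.size j) {y : BlockSeq F.u} (hy : y ∈ N.map F.coord) :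
    (fun l a => if l = j then y i (a + c) else 0) ∈ N.map F.coord := by
  let C : Matrix (BlockIdx F.size) (BlockIdx F.size) ℂ :=
    Matrix.of fun p q => if p.1 = j ∧ q.1 = i ∧ (q.2 : ℕ) = p.2 + c then 1 else 0
  have hCx : ∀ x, ext F.size (C *ᵥ x) =
      fun l a => if l = j then ext F.size x i (a + c) else 0 := by
    intro x
    funext l a
    by_cases ha : a < F.size l
    · rw [ext_apply_of_lt _ ha]
      simp only [mulVec, dotProduct, C, of_apply, Fintype.sum_sigma]
      rw [Finset.sum_eq_single i]
      · by_cases hl : l = j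
        · simp only [hl, true_and, if_true]
          exact sum_ite_mul_eq x i _
        · simp [hl]
      · intro q _ hq
        exact Finset.sum_eq_zero fun b _ => by simp [hq]
      · simp
    · rw [ext_mem_bounded _ _ _ _ (not_lt.1 ha)]
      split_ifs with hl
      · subst hl
        exact (ext_mem_bounded _ x _ _ (by omega)).symm
      · rfl
  have hcomm : jordanMatrix F.size F.eig * C = C * jordanMatrix F.size F.eig := by
    apply Matrix.ext_of_mulVec_single
    intro p
    apply ext_injective
    rw [← mulVec_mulVec, ← mulVec_mulVec, ← toLin'_apply (jordanMatrix _ _) (C *ᵥ _),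
      (isCoord_ext F.size F.eig).map, hCx, hCx, ← toLin'_apply, (isCoord_ext F.size F.eig).map]
    funext l a
    simp only [jordan_apply]
    split_ifs with hl
    · rw [hl, hij, show a + 1 + c = a + c + 1 by omega]
    · simp
  have hB : Commute A (F.Q * C * F.Qinv) := by
    have hprod : ∀ X Y : Matrix (BlockIdx F.size) (BlockIdx F.size) ℂ,
        F.Q * X * F.Qinv * (F.Q * Y * F.Qinv) = F.Q * (X * Y) * F.Qinv := fun X Y => by
      calc F.Q * X * F.Qinv * (F.Q * Y * F.Qinv)
          = F.Q * X * (F.Qinv * F.Q) * Y * F.Qinv := by simp only [Matrix.mul_assoc]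
        _ = F.Q * (X * Y) * F.Qinv := by
            rw [F.Qinv_mul_Q, Matrix.mul_one]; simp only [Matrix.mul_assoc]
    have h1 := hprod (jordanMatrix F.size F.eig) C
    have h2 := hprod C (jordanMatrix F.size F.eig)
    rw [← F.eq_conj] at h1 h2
    change _ * _ = _ * _
    rw [h1, h2, hcomm]
  obtain ⟨v, hv, rfl⟩ := hy
  have h3 := mem_hyperinvariantLattice.1 hN _ hB hv
  refine ⟨_, h3, ?_⟩
  rw [toLin'_apply, Matrix.mul_assoc, ← mulVec_mulVec, F.coord_Q_mulVec, ← mulVec_mulVec, hCx]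
  rfl

/-- Projection to a single block turns any nonzero entry of a vector of `N` into evidence for a lead
at or above it, so `N` lies in `bounded r`; equal profiles give equality. Moving the last unit
vector of one block to another block then yields the inequalities on `r`. -/
lemma eq_initial_of_hyperinvariant (F : JordanForm A) {N : Submodule ℂ (Fin n → ℂ)}
    (hN : N ∈ hyperinvariantLattice A) :
    F.chainLength N ∈ F.hyperPowers ∧ N = F.initial (F.chainLength N) := by
  have hinv : N ∈ invariantLattice A := mem_hyperinvariantLattice.1 hN A (Commute.refl A)
  have hle := F.chainLength_le hinv
  have hprof := F.hasProfile hinv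
  set r := F.chainLength N
  have hmap : N.map F.coord = bounded r := by
    have hsub : N.map F.coord ≤ bounded r := by
      intro y hy i a ha
      by_contra hne
      have h1 := F.move_mem hN (rfl : F.eig i = F.eig i) (c := 0) (by omega) hy
      set y' : BlockSeq F.u := fun l a => if l = i then y i (a + 0) else 0
      have h2 : y' i a ≠ 0 := by simpa [y'] using hne
      have h3 : ∀ l b, y' l b ≠ 0 → l = i := fun l b h => by
        by_contra h'
        simp [y', h'] at h
      obtain ⟨j, b, -, hl⟩ := exists_hasLead (μ := F.eig) (z := F.eig i)
        (F.isCoord.map_le N h1) (fun l b h => by rw [h3 l b h])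
        (fun h => h2 (by rw [h]; rfl))
      obtain rfl := h3 _ _ hl.ne
      have h4 := (hprof j b).1 ⟨_, h1, hl⟩
      have h5 := pos_le_iff.1 (hl.le _ _ h2)
      omega
    refine le_antisymm hsub (le_of_hasLead hsub le_rfl (fun z v hv i a ha => ?_)
      (fun j a h => ?_) (fun j a => (hprof j a).2))
    · rw [component_apply, hv i a ha, ite_self]
    · obtain ⟨v, hv, hl⟩ := h
      exact lt_of_mem_bounded hv hl.ne
  refine ⟨⟨hle, fun i j hij he => ?_⟩, (F.eq_initial_iff hle).2 hmap⟩
  have hunit : ∀ l, 0 < r l → unit l (r l - 1) ∈ N.map F.coord := by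
    intro l hl
    rw [hmap]
    intro m b hb
    rw [unit_apply, if_neg]
    rintro ⟨rfl, rfl⟩
    omega
  have hsz := F.size_anti i j hij he
  have hlej := hle j
  constructor
  · by_contra! hlt
    have h1 := F.move_mem hN he.symm (c := 0) (by omega) (hunit j (by omega))
    rw [hmap] at h1
    have h2 := h1 i (r j - 1) (by omega)
    simp [unit_apply] at h2
  · by_contra! hlt
    -- The smallest displacement with which a longer block maps to a shorter one.
    have h1 := F.move_mem hN he (c := F.size i - F.size j) (by omega) (hunit i (by omega))
    rw [hmap] at h1
    have h2 := h1 j (r i - 1 - (F.size i - F.size j)) (by omega)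
    have h3 : r i - 1 - (F.size i - F.size j) + (F.size i - F.size j) = r i - 1 := by omega
    simp [unit_apply, h3] at h2

end JordanForm

/-! ### Existence of the Jordan form. -/

open Polynomial in
/-- Every matrix has a Jordan basis of chains indexed by a finite type. -/
lemma exists_jordan_chains {n : ℕ} (A : Matrix (Fin n) (Fin n) ℂ) :
    ∃ (ι : Type) (_ : Fintype ι) (e : ι → ℕ) (μ : ι → ℂ)
      (b : Module.Basis (Σ i, Fin (e i)) ℂ (Fin n → ℂ)), ∀ i,
      (∀ h : 0 < e i, A *ᵥ b ⟨i, 0, h⟩ = μ i • b ⟨i, 0, h⟩) ∧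
      (∀ (a : ℕ) (h : a + 1 < e i),
        A *ᵥ b ⟨i, a + 1, h⟩ = μ i • b ⟨i, a + 1, h⟩ + b ⟨i, a, Nat.lt_of_succ_lt h⟩) := by
  classical
  let f : Module.End ℂ (Fin n → ℂ) := Matrix.toLin' A
  obtain ⟨ι, hι, p, hp, e, ⟨E⟩⟩ := Module.equiv_directSum_of_isTorsion
    (Module.AEval.isTorsion_of_finiteDimensional ℂ (Fin n → ℂ) f)
  have hroot : ∀ i, ∃ z, Ideal.span {p i} = Ideal.span {X - C z} := by
    intro i
    -- The torsion module over ℂ[X] splits into cyclic modules of prime power order, and over ℂ the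
    -- primes are linear.
    obtain ⟨z, hz⟩ := IsAlgClosed.exists_root (p i) (degree_pos_of_irreducible (hp i)).ne'
    refine ⟨z, Ideal.span_singleton_eq_span_singleton.2 ?_⟩
    exact ((irreducible_X_sub_C z).associated_of_dvd (hp i) (dvd_iff_isRoot.2 hz)).symm
  choose μ hμ using hroot
  let g : ι → ℂ[X] := fun i => X - C (μ i)
  have hspan : ∀ i, (ℂ[X] ∙ p i ^ e i) = Ideal.span {g i ^ e i} := fun i => by
    change Ideal.span {p i ^ e i} = _
    rw [← Ideal.span_singleton_pow, hμ, Ideal.span_singleton_pow]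
  let gen : ι → Module.AEval' f := fun i =>
    E.symm (DirectSum.lof ℂ[X] ι (fun i => ℂ[X] ⧸ (ℂ[X] ∙ p i ^ e i)) i (Submodule.Quotient.mk 1))
  let x : ι → Fin n → ℂ := fun i => (Module.AEval.of ℂ (Fin n → ℂ) f).symm (gen i)
  have hx : ∀ i (q : ℂ[X]), aeval f q (x i) = (Module.AEval.of ℂ (Fin n → ℂ) f).symm
      (E.symm (DirectSum.lof ℂ[X] ι (fun i => ℂ[X] ⧸ (ℂ[X] ∙ p i ^ e i)) i
        (Submodule.Quotient.mk q))) := by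
    intro i q
    have h1 : (Submodule.Quotient.mk q : ℂ[X] ⧸ (ℂ[X] ∙ p i ^ e i)) =
        q • Submodule.Quotient.mk 1 := by
      rw [← Submodule.Quotient.mk_smul, smul_eq_mul, mul_one]
    rw [h1, map_smul, map_smul, Module.AEval.of_symm_smul]
    rfl
  have hzero : ∀ i (q : ℂ[X]), g i ^ e i ∣ q → aeval f q (x i) = 0 := by
    intro i q hq
    have : (Submodule.Quotient.mk q : ℂ[X] ⧸ (ℂ[X] ∙ p i ^ e i)) = 0 := by
      rw [Submodule.Quotient.mk_eq_zero, hspan]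
      exact Ideal.mem_span_singleton.2 hq
    rw [hx, this, map_zero, map_zero, map_zero]
  have hdvd : ∀ q : ι → ℂ[X], ∑ i, aeval f (q i) (x i) = 0 → ∀ i, g i ^ e i ∣ q i := by
    intro q hq i
    simp only [hx] at hq
    rw [← map_sum, ← map_sum, LinearEquiv.map_eq_zero_iff, LinearEquiv.map_eq_zero_iff] at hq
    have h1 := congrArg
      (DirectSum.component ℂ[X] ι (fun i => ℂ[X] ⧸ (ℂ[X] ∙ p i ^ e i)) i) hq
    rw [map_sum, map_zero, Finset.sum_eq_single i] at h1
    · rw [DirectSum.component.lof_self, Submodule.Quotient.mk_eq_zero, hspan] at h1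
      exact Ideal.mem_span_singleton.1 h1
    · intro j _ hj
      rw [DirectSum.component.of, dif_neg hj]
    · simp
  -- Powers of `f - μ i` applied to the cyclic generator, in reversed order so that position `0` is
  -- the eigenvector.
  let c : (Σ i, Fin (e i)) → Fin n → ℂ := fun q => aeval f (g q.1 ^ (e q.1 - 1 - q.2)) (x q.1)
  have hli : LinearIndependent ℂ c := by
    rw [Fintype.linearIndependent_iff]
    intro α hα
    rw [Fintype.sum_sigma] at hα
    let h : ι → ℂ[X] := fun i => ∑ a : Fin (e i), C (α ⟨i, a⟩) * X ^ (e i - 1 - (a : ℕ))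
    have h1 : ∀ i, ∑ a, α ⟨i, a⟩ • c ⟨i, a⟩ = aeval f ((h i).comp (g i)) (x i) := by
      intro i
      simp only [h, c, aeval_comp, map_sum, LinearMap.sum_apply, map_mul, aeval_C,
        Module.End.mul_apply, Module.algebraMap_end_apply, map_pow, aeval_X]
    simp only [h1] at hα
    rintro ⟨i, a⟩
    have h2 := hdvd _ hα i
    have h3 : X ^ e i ∣ h i := by
      obtain ⟨q, hq⟩ := h2
      refine ⟨q.comp (X + C (μ i)), ?_⟩
      have h4 := congrArg (fun r => r.comp (X + C (μ i))) hq
      simpa [g, comp_assoc, mul_comp, pow_comp] using h4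
    have h5 := X_pow_dvd_iff.1 h3 (e i - 1 - a) (by have := a.2; omega)
    simp only [h, finsetSum_coeff, coeff_C_mul, coeff_X_pow] at h5
    rw [Finset.sum_eq_single a] at h5
    · simpa using h5
    · intro b _ hb
      rw [if_neg, mul_zero]
      intro hab
      apply hb
      ext
      have := a.2
      have := b.2
      omega
    · simp
  have hsp : ⊤ ≤ Submodule.span ℂ (Set.range c) := by
    have hgen : ∀ i (q : ℂ[X]), aeval f q (x i) ∈ Submodule.span ℂ (Set.range c) := by
      intro i q
      -- The Taylor expansion at `μ i` writes any polynomial multiple of the generator through chain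
      -- vectors.
      rw [← sum_taylor_eq q (μ i), Polynomial.sum, map_sum, LinearMap.sum_apply]
      refine Submodule.sum_mem _ fun k _ => ?_
      rw [map_mul, aeval_C, Module.End.mul_apply, Module.algebraMap_end_apply]
      refine Submodule.smul_mem _ _ ?_
      by_cases hk : k < e i
      · refine Submodule.subset_span ⟨⟨i, e i - 1 - k, by omega⟩, ?_⟩
        simp only [c]
        rw [show e i - 1 - (e i - 1 - k) = k by omega]
      · rw [hzero i _ (pow_dvd_pow _ (not_lt.1 hk))]
        exact Submodule.zero_mem _
    intro v _
    have hv : v = (Module.AEval.of ℂ (Fin n → ℂ) f).symm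
        (E.symm (E (Module.AEval.of ℂ (Fin n → ℂ) f v))) := by simp
    rw [hv]
    induction E (Module.AEval.of ℂ (Fin n → ℂ) f v) using DirectSum.induction_on with
    | zero => simp
    | of i y =>
      obtain ⟨q, rfl⟩ := Submodule.Quotient.mk_surjective _ y
      have := hgen i q
      rwa [hx] at this
    | add y z hy hz =>
      rw [map_add, map_add]
      exact Submodule.add_mem _ hy hz
  refine ⟨ι, hι, e, μ, Module.Basis.mk hli hsp, fun i => ?_⟩
  have hA : ∀ a : ℕ, A *ᵥ aeval f (g i ^ a) (x i) =
      μ i • aeval f (g i ^ a) (x i) + aeval f (g i ^ (a + 1)) (x i) := by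
    intro a
    rw [pow_succ', map_mul, Module.End.mul_apply]
    simp only [g, map_sub, aeval_X, aeval_C, LinearMap.sub_apply, Module.algebraMap_end_apply]
    simp [f]
  refine ⟨fun h => ?_, fun a h => ?_⟩
  · rw [Module.Basis.mk_apply]
    simp only [c]
    rw [hA, hzero i (g i ^ (_ + 1)) (pow_dvd_pow _ (by simp; omega)), add_zero]
  · rw [Module.Basis.mk_apply, Module.Basis.mk_apply]
    simp only [c]
    rw [hA, show e i - 1 - (a + 1) + 1 = e i - 1 - a by omega]

/-- Every complex matrix has a Jordan form. -/
theorem nonempty_jordanForm {n : ℕ} (A : Matrix (Fin n) (Fin n) ℂ) : Nonempty (JordanForm A) := by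
  classical
  obtain ⟨ι, _, e, μ, b, hb⟩ := exists_jordan_chains A
  -- Trivial cyclic summands are dropped. The remaining blocks are sorted by decreasing size alone,
  -- which also orders those of each eigenvalue.
  let ι' := {i : ι // 0 < e i}
  let σ := Fintype.equivFin ι'
  let τ := Tuple.sort fun i => OrderDual.toDual (e (σ.symm i).1)
  have hτ : Monotone ((fun i => OrderDual.toDual (e (σ.symm i).1)) ∘ τ) := Tuple.monotone_sort _
  let ρ : Fin (Fintype.card ι') ≃ ι' := τ.trans σ.symm
  let s : Fin (Fintype.card ι') → ℕ := fun i => e (ρ i).1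
  let m : BlockIdx s → Σ i, Fin (e i) := fun p => ⟨(ρ p.1).1, p.2⟩
  have hm : Function.Bijective m := by
    constructor
    · rintro ⟨i, a⟩ ⟨j, c⟩ h
      simp only [m, Sigma.mk.injEq] at h
      obtain ⟨h1, h2⟩ := h
      obtain rfl := ρ.injective (Subtype.ext h1)
      rw [eq_of_heq h2]
    · rintro ⟨i, a⟩
      have hi : 0 < e i := (Nat.zero_le _).trans_lt a.2
      obtain ⟨j, hj⟩ := ρ.surjective ⟨i, hi⟩
      have hj' : (ρ j).1 = i := congrArg Subtype.val hj
      subst hj'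
      exact ⟨⟨j, a⟩, rfl⟩
  let B : Module.Basis (BlockIdx s) ℂ (Fin n → ℂ) := b.reindex (Equiv.ofBijective m hm).symm
  have hB : ∀ p, B p = b (m p) := fun p => by simp [B]
  let L : (BlockIdx s → ℂ) →ₗ[ℂ] (Fin n → ℂ) := B.equivFun.symm.toLinearMap
  let L' : (Fin n → ℂ) →ₗ[ℂ] (BlockIdx s → ℂ) := B.equivFun.toLinearMap
  have h1 : LinearMap.toMatrix' L * LinearMap.toMatrix' L' = 1 := by
    rw [← LinearMap.toMatrix'_comp]
    simp [L, L']
  have h2 : LinearMap.toMatrix' L' * LinearMap.toMatrix' L = 1 := by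
    rw [← LinearMap.toMatrix'_comp]
    simp [L, L']
  have h3 : A * LinearMap.toMatrix' L =
      LinearMap.toMatrix' L * jordanMatrix s (fun i => μ (ρ i).1) := by
    apply Matrix.ext_of_mulVec_single
    rintro ⟨i, a, ha⟩
    have hL : ∀ p, LinearMap.toMatrix' L *ᵥ Pi.single p 1 = b (m p) := by
      intro p
      rw [LinearMap.toMatrix'_mulVec, ← hB]
      simp [L, Module.Basis.equivFun_symm_apply, Pi.single_apply]
    rw [← mulVec_mulVec, ← mulVec_mulVec, BlockSeq.jordanMatrix_mulVec_single, mulVec_add,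
      mulVec_smul, hL]
    rcases a with _ | a
    · have := (hb (ρ i).1).1 ha
      simpa using this
    · have := (hb (ρ i).1).2 a ha
      rw [dif_pos (Nat.succ_pos a), hL]
      exact this
  exact ⟨{
    u := Fintype.card ι'
    size := s
    eig := fun i => μ (ρ i).1
    size_pos := fun i => (ρ i).2
    size_anti := fun i j hij _ => hτ hij
    Q := LinearMap.toMatrix' L
    Qinv := LinearMap.toMatrix' L'
    Q_mul_Qinv := h1
    Qinv_mul_Q := h2
    eq_conj := by rw [← h3, Matrix.mul_assoc, h1, Matrix.mul_one] }⟩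

/-! ### The correspondences of types, and the theorem. -/

namespace JordanForm

variable {n : ℕ} {A : Matrix (Fin n) (Fin n) ℂ}

open BlockSeq

/-- The powers as matrices, ordered by inclusion of kernels. -/
noncomputable def powersOrderIso (F : JordanForm A) : Set.Iic F.size ≃o F.ZMatrix where
  toEquiv := Equiv.ofBijective
    (fun k => (⟨shiftMatrix (F.expandedSize Set.univ) k.1, k.1, k.2, rfl⟩ : F.ZMatrix))
    ⟨fun k l h => Subtype.ext (shiftMatrix_injOn (k.2.trans (F.size_le_expandedSize _))
      (l.2.trans (F.size_le_expandedSize _)) (congrArg Subtype.val h)), by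
      rintro ⟨_, k, hk, rfl⟩
      exact ⟨⟨k, hk⟩, rfl⟩⟩
  map_rel_iff' {k l} := shiftMatrix_ker_le_iff (k.2.trans (F.size_le_expandedSize _))

lemma powersOrderIso_apply (F : JordanForm A) (k : Set.Iic F.size) :
    (F.powersOrderIso k).1 = shiftMatrix (F.expandedSize Set.univ) k.1 := rfl

lemma chainLength_mono (F : JordanForm A) {N M : Submodule ℂ (Fin n → ℂ)}
    (hN : N ∈ invariantLattice A) (hM : M ∈ invariantLattice A) (h : N ≤ M) :
    F.chainLength N ≤ F.chainLength M :=
  (F.hasProfile hN).mono (F.hasProfile hM) (Submodule.map_mono h)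

/-- The types of invariant subspaces as chain lengths. -/
noncomputable def typesOrderIso (F : JordanForm A) : F.InvType ≃o Set.Iic F.size where
  toEquiv := Equiv.ofBijective
    (Quotient.lift (fun N : invariantLattice A =>
      (⟨F.chainLength N.1, F.chainLength_le N.2⟩ : Set.Iic F.size))
      fun _ _ h => Subtype.ext h)
    ⟨by
      rintro ⟨N⟩ ⟨M⟩ h
      exact Quotient.sound (congrArg Subtype.val h), by
      rintro ⟨k, hk⟩
      exact ⟨Quotient.mk _ ⟨F.initial k, F.initial_mem k⟩, Subtype.ext (F.chainLength_initial hk)⟩⟩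
  map_rel_iff' {x y} := by
    induction x using Quotient.inductionOn with | _ N
    induction y using Quotient.inductionOn with | _ M
    constructor
    · intro h
      -- The given subspaces need not be nested, but the initial subspaces of the same types are.
      refine ⟨⟨_, F.initial_mem (F.chainLength N.1)⟩, ⟨_, F.initial_mem (F.chainLength M.1)⟩,
        Submodule.comap_mono (bounded_mono h), ?_, ?_⟩
      · exact Quotient.sound (F.chainLength_initial (F.chainLength_le N.2))
      · exact Quotient.sound (F.chainLength_initial (F.chainLength_le M.2))
    · rintro ⟨N', M', h, hN, hM⟩
      have h1 : F.chainLength N'.1 = F.chainLength N.1 := Quotient.exact hN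
      have h2 : F.chainLength M'.1 = F.chainLength M.1 := Quotient.exact hM
      change F.chainLength N.1 ≤ F.chainLength M.1
      rw [← h1, ← h2]
      exact F.chainLength_mono N'.2 M'.2 h

lemma typesOrderIso_mk (F : JordanForm A) (N : invariantLattice A) :
    (F.typesOrderIso (Quotient.mk _ N)).1 = F.chainLength N.1 := rfl

/-- The matrix constructed for an invariant subspace. -/
noncomputable def producedMatrix (F : JordanForm A) (N : invariantLattice A) : F.zList :=
  ⟨⟨F.expandedSize (nonMarkedEigenvalues A N.1), shiftMatrix _ (F.chainLength N.1)⟩,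
    F.chainLength N.1, F.chainLength_le N.2, nonMarkedEigenvalues A N.1,
    fun _ hz => F.exists_gap N.2 ((F.mem_nonMarkedEigenvalues_iff N.2).1 hz), rfl⟩

/-- The refined types of invariant subspaces as matrices. -/
noncomputable def refinedTypesEquiv (F : JordanForm A) : Quotient F.refinedSetoid ≃ F.zList :=
  Equiv.ofBijective
    (Quotient.lift F.producedMatrix fun N M h => by
      obtain ⟨h1, h2⟩ := Prod.mk.inj h
      apply Subtype.ext
      simp only [producedMatrix]
      rw [h1, h2])
    ⟨by
      rintro ⟨N⟩ ⟨M⟩ h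
      obtain ⟨h1, h2⟩ := sigma_shiftMatrix_inj
        ((F.chainLength_le N.2).trans (F.size_le_expandedSize _))
        ((F.chainLength_le M.2).trans (F.size_le_expandedSize _)) (congrArg Subtype.val h)
      exact Quotient.sound (Prod.ext h2 ((F.subset_of_expandedSize_eq N.2 h1).antisymm
        (F.subset_of_expandedSize_eq M.2 h1.symm))), by
      rintro ⟨_, k, hk, E, hE, rfl⟩
      obtain ⟨N, hN, h1, h2⟩ := F.exists_of_gaps hk hE
      refine ⟨Quotient.mk _ ⟨N, hN⟩, Subtype.ext ?_⟩
      simp only [Quotient.lift_mk, producedMatrix]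
      rw [h1, h2]⟩

/-- The initial subspaces as a lattice homomorphism. -/
def initialHom (F : JordanForm A) : LatticeHom (Set.Iic F.size) (invariantLattice A) where
  toFun k := ⟨F.initial k.1, F.initial_mem k.1⟩
  map_sup' k l := Subtype.ext (F.initial_sup k.2 l.2)
  map_inf' k l := Subtype.ext (F.initial_inf k.1 l.1)

/-- An unexpanded matrix only gives `N` as the image of the initial subspace under some T. As T and
T⁻¹ commute with J, both preserve this subspace when `r` is a hyperinvariant power, so `N` is the
initial subspace itself. -/
lemma mem_hyperinvariantLattice_iff (F : JordanForm A) (N : Submodule ℂ (Fin n → ℂ)) :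
    N ∈ hyperinvariantLattice A ↔ ∃ r ∈ F.hyperPowers, N ∈ invariantLattice A ∧
      F.Produces N ⟨F.size, shiftMatrix F.size r⟩ := by
  constructor
  · intro hN
    obtain ⟨h1, h2⟩ := F.eq_initial_of_hyperinvariant hN
    refine ⟨_, h1, mem_hyperinvariantLattice.1 hN A (Commute.refl A), ?_⟩
    have := F.initial_produces h1.1
    rwa [← h2] at this
  · rintro ⟨r, hr, hN, hp⟩
    obtain ⟨h1, h2⟩ := (F.produces_size_iff hN hr.1).1 hp
    have h3 := F.exists_represents hN (E := ∅) fun z _ => by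
      have hz : z ∉ nonMarkedEigenvalues A N := by rw [h1]; exact Set.notMem_empty z
      rwa [F.mem_nonMarkedEigenvalues_iff hN, not_not] at hz
    rw [h2, exists_represents_iff, F.expandedSize_empty] at h3
    obtain ⟨T, hT⟩ := h3
    have h4 : N = F.initial r := by
      rw [F.eq_initial_iff hr.1]
      ext y
      constructor
      · intro hy
        obtain ⟨x, hx, rfl⟩ := hT.exists_eq hy
        exact F.mulVec_mem_bounded hr hT.2.1 hx
      · intro hy
        obtain ⟨x, rfl⟩ := exists_ext_eq (bounded_mono hr.1 hy)
        have h5 := (hT.mulVec_mem_iff _).2 (F.mulVec_mem_bounded hr hT.commute_inv hy)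
        rwa [mulVec_mulVec, hT.mul_inv, one_mulVec] at h5
    rw [h4]
    exact F.initial_mem_hyperinvariantLattice hr

/-- The hyperinvariant subspaces as powers. -/
noncomputable def hyperinvariantOrderIso (F : JordanForm A) :
    hyperinvariantLattice A ≃o F.hyperPowers where
  toFun N := ⟨F.chainLength N.1, (F.eq_initial_of_hyperinvariant N.2).1⟩
  invFun r := ⟨F.initial r.1, F.initial_mem_hyperinvariantLattice r.2⟩
  left_inv N := Subtype.ext (F.eq_initial_of_hyperinvariant N.2).2.symm
  right_inv r := Subtype.ext (F.chainLength_initial r.2.1)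
  map_rel_iff' {N M} := by
    constructor
    · intro h
      change N.1 ≤ M.1
      rw [(F.eq_initial_of_hyperinvariant N.2).2, (F.eq_initial_of_hyperinvariant M.2).2]
      exact Submodule.comap_mono (bounded_mono h)
    · exact F.chainLength_mono (mem_hyperinvariantLattice.1 N.2 A (Commute.refl A))
        (mem_hyperinvariantLattice.1 M.2 A (Commute.refl A))

lemma isMarked_iff_exists_represents (F : JordanForm A) (N : Submodule ℂ (Fin n → ℂ)) :
    (N ∈ invariantLattice A ∧ IsMarked A N) ↔ ∃ k ≤ F.size, ∃ T, F.Represents ∅ k T N := by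
  constructor
  · rintro ⟨hN, hm⟩
    exact ⟨_, F.chainLength_le hN, F.exists_represents hN fun z _ => (F.isMarked_iff hN).1 hm z⟩
  · rintro ⟨k, hk, hT⟩
    have hN : N ∈ invariantLattice A := by
      obtain ⟨T, hT⟩ := hT
      exact F.mem_invariantLattice_of_represents hT
    exact ⟨hN, (F.isMarked_iff_nonMarkedEigenvalues hN).2 (F.nonMarkedEigenvalues_eq_empty hk hT)⟩

/-- Replacing the powers of a represented subspace. -/
lemma exists_change_powers (F : JordanForm A) {N : Submodule ℂ (Fin n → ℂ)} {E : Set ℂ}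
    {k : Fin F.u → ℕ} (h : ∃ T, F.Represents E k T N) (l : Fin F.u → ℕ)
    (hl : l ≤ k ∨ E = ∅) : ∃ M, (∃ T, F.Represents E l T M) ∧
      (l ≤ k → M ≤ N) ∧ (k ≤ l → N ≤ M) := by
  rw [exists_represents_iff] at h
  obtain ⟨T, hT⟩ := h
  obtain ⟨M, hM⟩ := hT.change l
  have hMs : M ≤ bounded F.size := by
    -- The new subspace must lie in the unexpanded space: smaller powers keep it inside `N`, and for
    -- larger powers there is no expansion to leave.
    rcases hl with hl | rfl
    · exact (hM.mono hT hl).trans (F.isCoord.map_le N)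
    · have := hM.le_bounded
      rwa [F.expandedSize_empty] at this
  have hmap := F.isCoord.map_comap hMs
  refine ⟨M.comap F.coord, (F.exists_represents_iff E l _).2 ⟨T, hmap.symm ▸ hM⟩, fun h => ?_,
    fun h => Submodule.map_le_iff_le_comap.1 (hT.mono hM h)⟩
  intro v hv
  obtain ⟨w, hw, hwv⟩ := hM.mono hT h hv
  rwa [F.isCoord.inj hwv] at hw

lemma sum_chainLength (F : JordanForm A) {N : Submodule ℂ (Fin n → ℂ)}
    (hN : N ∈ invariantLattice A) : ∑ i, F.chainLength N i = Module.finrank ℂ N := by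
  obtain ⟨T, hT⟩ := F.exists_represents hN (E := Set.univ) fun z hz => absurd (Set.mem_univ z) hz
  rw [(Submodule.equivMapOfInjective _ F.isCoord.inj N).finrank_eq]
  exact (((F.represents_iff _ _ _ _).1 hT).finrank_eq
    ((F.chainLength_le hN).trans (F.size_le_expandedSize _))).symm

end JordanForm

theorem theoremB (n : ℕ) (A : Matrix (Fin n) (Fin n) ℂ) :
    Nonempty (JordanForm A) ∧ ∀ F : JordanForm A,
      -- every invariant subspace, and nothing else, is constructed in the expanded space
      (∀ N : Submodule ℂ (Fin n → ℂ), N ∈ invariantLattice A ↔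
        ∃ k ≤ F.size, ∃ T, F.Represents Set.univ k T N) ∧
      -- the marked ones are exactly those constructed without any expansion
      (∀ N : Submodule ℂ (Fin n → ℂ), (N ∈ invariantLattice A ∧ IsMarked A N) ↔
        ∃ k ≤ F.size, ∃ T, F.Represents ∅ k T N) ∧
      -- the matrices `Z` form a lattice: order is comparison of the powers
      (∃ Θ : Set.Iic F.size ≃o F.ZMatrix,
        ∀ k, (Θ k).1 = shiftMatrix (F.expandedSize Set.univ) k.1) ∧
      -- the correspondence of types of invariant subspaces with the lattice of matrices `Z`
      (∃ Φ : F.InvType ≃o F.ZMatrix, ∀ (N : invariantLattice A) (k : Fin F.u → ℕ), k ≤ F.size →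
        ((∃ T, F.Represents Set.univ k T N.1) ↔
          (Φ (Quotient.mk _ N)).1 = shiftMatrix (F.expandedSize Set.univ) k)) ∧
      -- the sum of the powers is the dimension
      (∀ N ∈ invariantLattice A, ∑ i, F.chainLength N i = Module.finrank ℂ N) ∧
      -- the lattice of powers lifts to a lattice of marked invariant subspaces
      (∃ ψ : LatticeHom (Set.Iic F.size) (invariantLattice A),
        ∀ k, F.Produces (ψ k).1 ⟨F.size, shiftMatrix F.size k.1⟩) ∧
      -- below an invariant subspace all smaller powers occur
      (∀ N ∈ invariantLattice A, ∀ k ≤ F.chainLength N,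
        ∃ N' ∈ invariantLattice A, N' ≤ N ∧ F.chainLength N' = k) ∧
      -- above a marked invariant subspace all larger powers occur
      (∀ N ∈ invariantLattice A, IsMarked A N → ∀ k, F.chainLength N ≤ k → k ≤ F.size →
        ∃ N' ∈ invariantLattice A, N ≤ N' ∧ IsMarked A N' ∧ F.chainLength N' = k) ∧
      -- the correspondence when blocks are expanded only where the subspace is not marked
      (∃ Φ : Quotient F.refinedSetoid ≃ F.zList, ∀ (N : invariantLattice A) Z,
        F.Produces N.1 Z ↔ (Φ (Quotient.mk _ N)).1 = Z) ∧
      -- the sublattice of hyperinvariant subspaces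
      (∀ N : Submodule ℂ (Fin n → ℂ), N ∈ hyperinvariantLattice A ↔
        ∃ r ∈ F.hyperPowers, N ∈ invariantLattice A ∧
          F.Produces N ⟨F.size, shiftMatrix F.size r⟩) ∧
      (∃ Ψ : hyperinvariantLattice A ≃o F.hyperPowers,
        ∀ N, F.Produces N.1 ⟨F.size, shiftMatrix F.size (Ψ N).1⟩) := by
  refine ⟨nonempty_jordanForm A, fun F => ?_⟩
  have hrep : ∀ N ∈ invariantLattice A, ∃ T, F.Represents Set.univ (F.chainLength N) T N :=
    fun N hN => F.exists_represents hN fun z hz => absurd (Set.mem_univ z) hz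
  refine ⟨fun N => ⟨fun hN => ⟨_, F.chainLength_le hN, hrep N hN⟩,
      fun ⟨k, _, T, hT⟩ => F.mem_invariantLattice_of_represents hT⟩,
    F.isMarked_iff_exists_represents, ⟨F.powersOrderIso, F.powersOrderIso_apply⟩,
    ⟨F.typesOrderIso.trans F.powersOrderIso, fun N k hk => ?_⟩,
    fun N hN => F.sum_chainLength hN, ⟨F.initialHom, fun k => F.initial_produces k.2⟩,
    fun N hN k hk => ?_, fun N hN hm k hk hks => ?_,
    ⟨F.refinedTypesEquiv, fun N Z => (F.produces_iff N.2 Z).trans eq_comm⟩,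
    F.mem_hyperinvariantLattice_iff, ⟨F.hyperinvariantOrderIso, fun N => ?_⟩⟩
  · rw [OrderIso.trans_apply, F.powersOrderIso_apply, F.typesOrderIso_mk]
    constructor
    · rintro ⟨T, hT⟩
      rw [F.chainLength_eq_of_represents hk hT]
    · intro h
      rw [← BlockSeq.shiftMatrix_injOn ((F.chainLength_le N.2).trans (F.size_le_expandedSize _))
        (hk.trans (F.size_le_expandedSize _)) h]
      exact hrep N.1 N.2
  · have hks := hk.trans (F.chainLength_le hN)
    obtain ⟨M, ⟨T, hT⟩, h, -⟩ := F.exists_change_powers (hrep N hN) k (Or.inl hk)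
    exact ⟨M, F.mem_invariantLattice_of_represents hT, h hk, F.chainLength_eq_of_represents hks hT⟩
  · obtain ⟨M, hT, -, h⟩ := F.exists_change_powers (E := ∅)
      (F.exists_represents hN fun z _ => (F.isMarked_iff hN).1 hm z) k (Or.inr rfl)
    obtain ⟨hM, hMm⟩ := (F.isMarked_iff_exists_represents M).2 ⟨k, hks, hT⟩
    obtain ⟨T, hT⟩ := hT
    exact ⟨M, hM, h hk, hMm, F.chainLength_eq_of_represents hks hT⟩
  · obtain ⟨h1, h2⟩ := F.eq_initial_of_hyperinvariant N.2
    have := F.initial_produces h1.1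
    rwa [← h2] at this
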